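/- Let $E$ be a real or complex Hilbert space, let $A$ be a bounded linear operator on $E$ with adjoint $A'$, and let $D,\Sigma$ be symmetric bounded operators on $E$. Let $c_A,c_D,m_D,c_\Sigma>0$ be real numbers with $$A+A'\le -2c_A I,\qquad m_D I\le D\le c_D I,\qquad \Sigma\ge -c_\Sigma I$$ in the Loewner order, and suppose that $$c_A^2\ge c_Dc_\Sigma,\qquad c_\Sigma m_D>\Bigl(c_A-\sqrt{c_A^2-c_Dc_\Sigma}\Bigr)^2 .$$ Let $P\mapsto M_t(P)$ be the flow of the Riccati differential equation $\dot P=A'P+PA+D-P\Sigma P$ on the space of symmetric bounded operators, so that $t\mapsto M_t(P)$ is the maximal solution starting from $P$ at time $0$. For $\lambda>0$ let $(0,\lambda I]$ be the set of positive semi-definite invertible symmetric bounded operators $P$ with $P\le\lambda I$. For positive semi-definite invertible $P,Q$ let $d_T(P,Q)=\log\max\{M(P/Q),M(Q/P)\}$, where $M(P/Q)=\inf\{t\in\mathbb R: P\le tQ\}$, be the Thompson metric. Let $$\lambda\in\Bigl[\tfrac{c_A-\sqrt{c_A^2-c_Dc_\Sigma}}{c_\Sigma},\ \sqrt{\tfrac{m_D}{c_\Sigma}}\Bigr).$$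 Then for every $P\in(0,\lambda I]$ the solution $t\mapsto M_t(P)$ is unique, exists for all $t\ge0$ and stays in $(0,\lambda I]$, and there is $\alpha>0$ with $\alpha\ge (m_D-c_\Sigma\lambda^2)/\lambda$ such that for all $P_1,P_2\in(0,\lambda I]$ $$d_T(M_t(P_1),M_t(P_2))\le e^{-\alpha t}d_T(P_1,P_2),\qquad t\ge0.$$ Moreover the algebraic Riccati equation $A'P+PA+D-P\Sigma P=0$ has a unique solution $\bar P$ in $(0,\lambda I]$, and for every $P\in(0,\lambda I]$ $$d_T(M_t(P),\bar P)\le e^{-\alpha t}d_T(P,\bar P),\qquad t\ge0.$$ -/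

import Mathlib

noncomputable section

namespace Riccati

open Set

/-! ## Cauchy problems and flows in a real Banach space -/

section Flow

variable {X : Type*} [NormedAddCommGroup X] [NormedSpace ℝ X]

/-- `x` is a solution on `[0, a)` of the autonomous Cauchy problem `x' = φ(x)`, `x(0) = x₀`.
(At `0` the derivative is the right derivative. When `φ` is continuous, the derivative of a
solution is automatically continuous.) -/
def IsSolution (φ : X → X) (x₀ : X) (a : ℝ) (x : ℝ → X) : Prop :=
  x 0 = x₀ ∧ ∀ t ∈ Ico 0 a, HasDerivWithinAt x (φ (x t)) (Ico 0 a) t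

/-- The times `t ≥ 0` up to which the Cauchy problem `x' = φ(x)`, `x(0) = x₀` is solvable,
i.e. the interval of definition of the maximal solution. -/
def lifeInterval (φ : X → X) (x₀ : X) : Set ℝ :=
  {t | 0 ≤ t ∧ ∃ a x, t < a ∧ IsSolution φ x₀ a x}

open Classical in
/-- The flow: `flow φ t x₀` is the value at time `t` of the maximal solution of `x' = φ(x)`,
`x(0) = x₀` (and `0` for the times at which it does not exist). -/
def flow (φ : X → X) (t : ℝ) (x₀ : X) : X :=
  if h : t ∈ lifeInterval φ x₀ then h.2.choose_spec.choose t else 0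

end Flow

/-! ## The Thompson part metric -/

section Thompson

variable {X : Type*} [LE X] [SMul ℝ X]

/-- `M(x/y) = inf {t ∈ ℝ : x ≤ t y}`. -/
def maxRatio (x y : X) : ℝ := sInf {t : ℝ | x ≤ t • y}

/-- The Thompson part metric `d_T(x, y) = log max {M(x/y), M(y/x)}`. -/
def thompsonDist (x y : X) : ℝ := Real.log (max (maxRatio x y) (maxRatio y x))

end Thompson

/-! ## Symmetric operators on a real or complex Hilbert space -/

section Operators

variable (𝕜 E : Type*) [RCLike 𝕜] [NormedAddCommGroup E] [InnerProductSpace 𝕜 E]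
  [CompleteSpace E]

/-- The symmetric bounded operators on `E`, with the operator norm and the Loewner order
`P ≤ Q ↔ (Q - P).IsPositive`. -/
def SymOp : Type _ := selfAdjoint (E →L[𝕜] E)

instance SymOp.instNormedAddCommGroup : NormedAddCommGroup (SymOp 𝕜 E) :=
  inferInstanceAs (NormedAddCommGroup (selfAdjoint (E →L[𝕜] E)))

instance SymOp.instPartialOrder : PartialOrder (SymOp 𝕜 E) :=
  inferInstanceAs (PartialOrder (selfAdjoint (E →L[𝕜] E)))

/-- The identity operator. -/
instance SymOp.instOne : One (SymOp 𝕜 E) :=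
  inferInstanceAs (One (selfAdjoint (E →L[𝕜] E)))

instance SymOp.instCoeOut : CoeOut (SymOp 𝕜 E) (E →L[𝕜] E) := ⟨Subtype.val⟩

theorem SymOp.norm_def (P : SymOp 𝕜 E) : ‖P‖ = ‖(P : E →L[𝕜] E)‖ := rfl

theorem SymOp.le_iff (P Q : SymOp 𝕜 E) :
    P ≤ Q ↔ ((Q : E →L[𝕜] E) - (P : E →L[𝕜] E)).IsPositive := Iff.rfl

/-- The symmetric operators form a real vector space: `r • P` is the operator `(r : 𝕜) • P`. -/
instance SymOp.instModule : Module ℝ (SymOp 𝕜 E) where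
  smul r P := ⟨(r : 𝕜) • (P : E →L[𝕜] E), by
    rw [selfAdjoint.mem_iff, star_smul, RCLike.star_def, RCLike.conj_ofReal,
      selfAdjoint.mem_iff.mp P.2]⟩
  one_smul P := Subtype.ext (by
    change ((1 : ℝ) : 𝕜) • (P : E →L[𝕜] E) = P
    rw [RCLike.ofReal_one, one_smul])
  mul_smul r s P := Subtype.ext (by
    change ((r * s : ℝ) : 𝕜) • (P : E →L[𝕜] E) = (r : 𝕜) • (s : 𝕜) • (P : E →L[𝕜] E)
    rw [RCLike.ofReal_mul, mul_smul])
  smul_zero r := Subtype.ext (by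
    change (r : 𝕜) • (0 : E →L[𝕜] E) = 0
    rw [smul_zero])
  smul_add r P Q := Subtype.ext (by
    change (r : 𝕜) • ((P : E →L[𝕜] E) + Q) = (r : 𝕜) • (P : E →L[𝕜] E) + (r : 𝕜) • (Q : E →L[𝕜] E)
    rw [smul_add])
  add_smul r s P := Subtype.ext (by
    change ((r + s : ℝ) : 𝕜) • (P : E →L[𝕜] E) = (r : 𝕜) • (P : E →L[𝕜] E) + (s : 𝕜) • (P : E →L[𝕜] E)
    rw [RCLike.ofReal_add, add_smul])
  zero_smul P := Subtype.ext (by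
    change ((0 : ℝ) : 𝕜) • (P : E →L[𝕜] E) = 0
    rw [RCLike.ofReal_zero, zero_smul])

theorem SymOp.coe_smul (r : ℝ) (P : SymOp 𝕜 E) :
    ((r • P : SymOp 𝕜 E) : E →L[𝕜] E) = (r : 𝕜) • (P : E →L[𝕜] E) := rfl

theorem SymOp.coe_one : ((1 : SymOp 𝕜 E) : E →L[𝕜] E) = 1 := rfl

instance SymOp.instNormedSpace : NormedSpace ℝ (SymOp 𝕜 E) where
  norm_smul_le r P := by
    change ‖(r : 𝕜) • (P : E →L[𝕜] E)‖ ≤ ‖r‖ * ‖(P : E →L[𝕜] E)‖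
    rw [norm_smul, RCLike.norm_ofReal, Real.norm_eq_abs]

variable {𝕜 E}

/-- The Riccati field `φ(P) = A' P + P A + D - P S P`, where `A'` is the adjoint of `A`. -/
def riccatiField (A : E →L[𝕜] E) (D S P : SymOp 𝕜 E) : SymOp 𝕜 E :=
  ⟨star A * (P : E →L[𝕜] E) + (P : E →L[𝕜] E) * A + (D : E →L[𝕜] E)
      - (P : E →L[𝕜] E) * (S : E →L[𝕜] E) * (P : E →L[𝕜] E), by
    have hP := selfAdjoint.mem_iff.mp P.2
    have hD := selfAdjoint.mem_iff.mp D.2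
    have hS := selfAdjoint.mem_iff.mp S.2
    rw [selfAdjoint.mem_iff]
    simp only [star_sub, star_add, star_mul, star_star, hP, hD, hS]
    rw [add_comm ((P : E →L[𝕜] E) * A), mul_assoc]⟩

/-- The algebraic Riccati equation `A' P + P A + D - P S P = 0`. -/
def SolvesARE (A : E →L[𝕜] E) (D S P : SymOp 𝕜 E) : Prop :=
  star A * (P : E →L[𝕜] E) + (P : E →L[𝕜] E) * A + (D : E →L[𝕜] E)
    - (P : E →L[𝕜] E) * (S : E →L[𝕜] E) * (P : E →L[𝕜] E) = 0

variable (𝕜 E) in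
/-- The set `(0, r I]` of the positive semi-definite invertible operators `P` with `P ≤ r I`. -/
def posUpTo (r : ℝ) : Set (SymOp 𝕜 E) :=
  {P | (P : E →L[𝕜] E).IsPositive ∧ IsUnit (P : E →L[𝕜] E) ∧ P ≤ r • (1 : SymOp 𝕜 E)}

end Operators

end Riccati

end

/-!
Let `φ` be the Riccati field. The field satisfies `φ(P) - φ(Q) = R'(P - Q) + (P - Q)R` with
`R = A - S(P + Q)/2`, and `W ↦ (1 + hR)' W (1 + hR)` preserves the positive cone. Hence a solution
of a Lyapunov inequality moves away from the cone at a rate at most proportional to its distance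
from it, so by Grönwall it never leaves, and subsolutions stay below supersolutions.
Choosing `r` between the two roots of the scalar equation makes `r I` a supersolution.

For the contraction, `φ(cP) - cφ(P) = (1 - c)(D + cPSP) ≥ (1 - c)(m_D - c_S r²)I` for `0 ≤ c ≤ 1`
and `0 ≤ P ≤ rI`. With `α = (m_D - c_S r²)/r` and `w(t) = exp(-αt) s`, this makes `exp(-w) P` a
subsolution whenever `P` is a solution, because `w exp(-w) ≤ 1 - exp(-w)`. Comparing it with a
second solution `Q` propagates `P ≤ exp(s) Q` at time `0` to `P ≤ exp(w(t)) Q` at time `t`. The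
equilibrium is the limit of the flow, which is Cauchy by the contraction.
-/

noncomputable section

namespace Riccati

open Set Filter Topology
open scoped InnerProductSpace NNReal

section CauchyProblem

variable {X : Type*} [NormedAddCommGroup X]

/-- `φ` is Lipschitz on every bounded set. Unlike local Lipschitz continuity, in infinite
dimensions this gives local solutions a lifetime that is uniform on bounded sets. -/
def LipschitzOnBounded (φ : X → X) : Prop :=
  ∀ ρ : ℝ, ∃ K : ℝ≥0, LipschitzOnWith K φ (Metric.closedBall 0 ρ)

variable {φ : X → X} {x₀ : X} {a b s t : ℝ} {x y : ℝ → X}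

theorem LipschitzOnBounded.continuous (hφ : LipschitzOnBounded φ) : Continuous φ := by
  refine continuous_iff_continuousAt.mpr fun x => ?_
  obtain ⟨K, hK⟩ := hφ (‖x‖ + 1)
  exact hK.continuousOn.continuousAt <| Metric.closedBall_mem_nhds_of_mem <| by simp

theorem LipschitzOnBounded.exists_norm_le (hφ : LipschitzOnBounded φ) {ρ : ℝ} (hρ : 0 ≤ ρ) :
    ∃ C : ℝ≥0, ∀ x, ‖x‖ ≤ ρ → ‖φ x‖ ≤ C := by
  obtain ⟨K, hK⟩ := hφ ρ
  refine ⟨⟨‖φ 0‖ + K * ρ, by positivity⟩, fun x hx => ?_⟩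
  have h := hK.norm_sub_le (mem_closedBall_zero_iff.mpr hx) (Metric.mem_closedBall_self hρ)
  calc ‖φ x‖ ≤ ‖φ 0‖ + ‖φ x - φ 0‖ := norm_le_norm_add_norm_sub' _ _
    _ ≤ ‖φ 0‖ + K * ρ := by rw [sub_zero] at h; gcongr; exact h.trans (by gcongr)

variable [NormedSpace ℝ X]

theorem IsSolution.mono (h : IsSolution φ x₀ a x) (hba : b ≤ a) : IsSolution φ x₀ b x :=
  ⟨h.1, fun t ht => (h.2 t (Ico_subset_Ico_right hba ht)).mono (Ico_subset_Ico_right hba)⟩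

theorem IsSolution.continuousOn_Icc (h : IsSolution φ x₀ a x) (hb : b < a) :
    ContinuousOn x (Icc 0 b) := fun t ht =>
  (h.2 t ⟨ht.1, ht.2.trans_lt hb⟩).continuousWithinAt.mono (Icc_subset_Ico_right hb)

theorem IsSolution.hasDerivWithinAt_Ici (h : IsSolution φ x₀ a x) (ht : t ∈ Ico 0 a) :
    HasDerivWithinAt x (φ (x t)) (Ici t) t :=
  (h.2 t ht).mono_of_mem_nhdsWithin <|
    mem_of_superset (Ico_mem_nhdsGE ht.2) (Ico_subset_Ico_left ht.1)

theorem IsSolution.hasDerivAt (h : IsSolution φ x₀ a x) (ht : t ∈ Ioo 0 a) :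
    HasDerivAt x (φ (x t)) t :=
  (h.2 t (Ioo_subset_Ico_self ht)).hasDerivAt (Ico_mem_nhds ht.1 ht.2)

theorem IsSolution.eqOn (hφ : LipschitzOnBounded φ) (hx : IsSolution φ x₀ a x)
    (hy : IsSolution φ x₀ b y) : EqOn x y (Ico 0 (min a b)) := by
  rintro t ⟨ht, htab⟩
  obtain ⟨hta, htb⟩ := lt_min_iff.mp htab
  obtain ⟨C₁, hC₁⟩ := isCompact_Icc.exists_bound_of_continuousOn (hx.continuousOn_Icc hta)
  obtain ⟨C₂, hC₂⟩ := isCompact_Icc.exists_bound_of_continuousOn (hy.continuousOn_Icc htb)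
  obtain ⟨K, hK⟩ := hφ (max C₁ C₂)
  refine ODE_solution_unique_of_mem_Icc_right (v := fun _ => φ)
    (s := fun _ => Metric.closedBall 0 (max C₁ C₂)) (fun _ _ => hK)
    (hx.continuousOn_Icc hta) (fun s hs => hx.hasDerivWithinAt_Ici ⟨hs.1, hs.2.trans hta⟩)
    (fun s hs => ?_)
    (hy.continuousOn_Icc htb) (fun s hs => hy.hasDerivWithinAt_Ici ⟨hs.1, hs.2.trans htb⟩)
    (fun s hs => ?_) (hx.1.trans hy.1.symm) ⟨ht, le_rfl⟩
  · exact mem_closedBall_zero_iff.mpr ((hC₁ s (Ico_subset_Icc_self hs)).trans (le_max_left _ _))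
  · exact mem_closedBall_zero_iff.mpr ((hC₂ s (Ico_subset_Icc_self hs)).trans (le_max_right _ _))

theorem IsSolution.shift (h : IsSolution φ x₀ a x) (hs : 0 ≤ s) :
    IsSolution φ (x s) (a - s) fun t => x (t + s) := by
  refine ⟨by simp only [zero_add], fun t ht => ?_⟩
  have hmaps : MapsTo (· + s) (Ico 0 (a - s)) (Ico 0 a) := fun u hu =>
    ⟨add_nonneg hu.1 hs, lt_sub_iff_add_lt.mp hu.2⟩
  rw [← one_smul ℝ (φ (x (t + s)))]
  exact (h.2 (t + s) (hmaps ht)).scomp t ((hasDerivWithinAt_id t _).add_const s) hmaps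

theorem IsSolution.exists_extension (hφ : LipschitzOnBounded φ) (hx : IsSolution φ x₀ a x)
    (hs : s ∈ Ico 0 a) (hy : IsSolution φ (x s) b y) : ∃ z, IsSolution φ x₀ (s + b) z := by
  set z : ℝ → X := fun t => if t < s then x t else y (t - s)
  have hzy : ∀ t, s ≤ t → z t = y (t - s) := fun t ht => if_neg ht.not_gt
  have hzx : EqOn z x (Ico 0 (min a (s + b))) := by
    rintro t ⟨-, ht⟩
    obtain ⟨hta, htb⟩ := lt_min_iff.mp ht
    rcases lt_or_ge t s with hts | hts
    · exact if_pos hts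
    · have : x (t - s + s) = y (t - s) := (hx.shift hs.1).eqOn hφ hy
        ⟨sub_nonneg.mpr hts, lt_min (by linarith) (by linarith)⟩
      rw [hzy t hts, ← this, sub_add_cancel]
  refine ⟨z, ?_, fun t ht => ?_⟩
  · rcases hs.1.eq_or_lt with rfl | hs0
    · rw [hzy 0 le_rfl, sub_self, hy.1, hx.1]
    · exact (if_pos hs0).trans hx.1
  rcases lt_or_ge t a with hta | hta
  · have hmem : t ∈ Ico 0 (min a (s + b)) := ⟨ht.1, lt_min hta ht.2⟩
    have h := (hx.mono (min_le_left a (s + b))).2 t hmem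
    rw [hzx hmem]
    exact (h.congr hzx (hzx hmem)).mono_of_mem_nhdsWithin
      (mem_nhdsWithin.mpr ⟨Iio a, isOpen_Iio, hta, fun u hu => ⟨hu.2.1, lt_min hu.1 hu.2.2⟩⟩)
  · have hst : s < t := hs.2.trans_le hta
    have h := (hy.hasDerivAt ⟨sub_pos.mpr hst, sub_lt_iff_lt_add'.mpr ht.2⟩).comp_sub_const t s
    rw [hzy t hst.le]
    refine (h.congr_of_eventuallyEq ?_).hasDerivWithinAt
    filter_upwards [Ioi_mem_nhds hst] with u hu using hzy u hu.le

theorem LipschitzOnBounded.exists_isSolution [CompleteSpace X] (hφ : LipschitzOnBounded φ)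
    {ρ : ℝ} (hρ : 0 ≤ ρ) : ∃ τ > 0, ∀ x₀, ‖x₀‖ ≤ ρ → ∃ x, IsSolution φ x₀ τ x := by
  obtain ⟨K, hK⟩ := hφ (ρ + 1)
  obtain ⟨C, hC⟩ := hφ.exists_norm_le (add_nonneg hρ zero_le_one)
  refine ⟨1 / (C + 1), by positivity, fun x₀ hx₀ => ?_⟩
  have hball : Metric.closedBall x₀ 1 ⊆ Metric.closedBall 0 (ρ + 1) :=
    Metric.closedBall_subset_closedBall' (by rw [dist_zero_right]; linarith)
  have hpl : IsPicardLindelof (fun _ : ℝ => φ) (tmin := 0) (tmax := 1 / (C + 1))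
      ⟨0, le_rfl, by positivity⟩ x₀ 1 0 C K := by
    refine .of_time_independent (fun x hx => hC x (mem_closedBall_zero_iff.mp (hball hx)))
      (hK.mono hball) ?_
    have : (C : ℝ) * (1 / (C + 1)) ≤ 1 := by
      rw [mul_one_div]
      exact div_le_one_of_le₀ (by linarith) (by positivity)
    rw [sub_zero, sub_self, max_eq_left (by positivity)]
    simpa using this
  obtain ⟨x, hx0, hx⟩ := hpl.exists_eq_forall_mem_Icc_hasDerivWithinAt₀
  exact ⟨x, hx0, fun t ht => (hx t (Ico_subset_Icc_self ht)).mono Ico_subset_Icc_self⟩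

theorem exists_isSolution_of_forall_norm_le [CompleteSpace X] (hφ : LipschitzOnBounded φ) {ρ : ℝ}
    (hρ : ∀ a x, IsSolution φ x₀ a x → ∀ t ∈ Ico 0 a, ‖x t‖ ≤ ρ) (a : ℝ) :
    ∃ x, IsSolution φ x₀ a x := by
  obtain ⟨τ, hτ, hloc⟩ := hφ.exists_isSolution (ρ := max ρ ‖x₀‖) (by positivity)
  have hsteps : ∀ n : ℕ, ∃ x, IsSolution φ x₀ (n * (τ / 2) + τ) x := by
    intro n
    induction n with
    | zero => simpa only [Nat.cast_zero, zero_mul, zero_add] using hloc x₀ (le_max_right _ _)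
    | succ n ih =>
      obtain ⟨x, hx⟩ := ih
      have hs : n * (τ / 2) + τ / 2 ∈ Ico 0 (n * (τ / 2) + τ) := ⟨by positivity, by linarith⟩
      obtain ⟨y, hy⟩ := hloc _ ((hρ _ x hx _ hs).trans (le_max_left _ _))
      obtain ⟨z, hz⟩ := hx.exists_extension hφ hs hy
      exact ⟨z, hz.mono (by push_cast; linarith)⟩
  obtain ⟨n, hn⟩ := exists_nat_ge (a / (τ / 2))
  obtain ⟨x, hx⟩ := hsteps n
  exact ⟨x, hx.mono (by linarith [(div_le_iff₀ (half_pos hτ)).mp hn])⟩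

theorem IsSolution.eq_flow (hφ : LipschitzOnBounded φ) (hx : IsSolution φ x₀ a x)
    (ht : t ∈ Ico 0 a) : x t = flow φ t x₀ := by
  have h : t ∈ lifeInterval φ x₀ := ⟨ht.1, a, x, ht.2, hx⟩
  rw [flow, dif_pos h]
  obtain ⟨hlt, hsol⟩ := h.2.choose_spec.choose_spec
  exact hx.eqOn hφ hsol ⟨ht.1, lt_min ht.2 hlt⟩

theorem isSolution_flow (hφ : LipschitzOnBounded φ) (h : ∀ a, ∃ x, IsSolution φ x₀ a x) (a : ℝ) :
    IsSolution φ x₀ a fun t => flow φ t x₀ := by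
  obtain ⟨x, hx⟩ := h (max a 1)
  have heq : EqOn (fun t => flow φ t x₀) x (Ico 0 (max a 1)) := fun t ht => (hx.eq_flow hφ ht).symm
  refine IsSolution.mono ⟨(heq ⟨le_rfl, by simp⟩).trans hx.1, fun t ht => ?_⟩ (le_max_left a 1)
  exact heq ht ▸ (hx.2 t ht).congr heq (heq ht)

theorem flow_add (hφ : LipschitzOnBounded φ) (h : ∀ a, ∃ x, IsSolution φ x₀ a x)
    (ht : 0 ≤ t) (hs : 0 ≤ s) : flow φ (t + s) x₀ = flow φ t (flow φ s x₀) :=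
  ((isSolution_flow hφ h (t + s + 1)).shift hs).eq_flow hφ ⟨ht, by linarith⟩

theorem flow_eq_self (hφ : LipschitzOnBounded φ) (h : φ x₀ = 0) (ht : 0 ≤ t) :
    flow φ t x₀ = x₀ :=
  have hconst : IsSolution φ x₀ (t + 1) fun _ => x₀ :=
    ⟨rfl, fun u _ => h ▸ hasDerivWithinAt_const u _ x₀⟩
  (hconst.eq_flow hφ ⟨ht, lt_add_one t⟩).symm

theorem eq_zero_of_tendsto_of_tendsto_deriv {f f' : ℝ → X} {y v : X}
    (hf : ∀ t > 0, HasDerivAt f (f' t) t) (hy : Tendsto f atTop (𝓝 y))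
    (hv : Tendsto f' atTop (𝓝 v)) : v = 0 := by
  have hshift : Tendsto (fun t => f (t + 1) - f t) atTop (𝓝 0) := by
    rw [← sub_self y]
    exact (hy.comp (tendsto_atTop_add_const_right _ 1 tendsto_id)).sub hy
  refine tendsto_nhds_unique (Metric.tendsto_nhds.mpr fun ε hε => ?_) hshift
  obtain ⟨T, hT⟩ := eventually_atTop.mp (Metric.tendsto_nhds.mp hv (ε / 2) (half_pos hε))
  filter_upwards [eventually_ge_atTop T, eventually_gt_atTop 0] with t htT ht0
  have hbound := (convex_Ici t).norm_image_sub_le_of_norm_hasDerivWithin_le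
    (f := fun u => f u - u • v) (f' := fun u => f' u - v) (C := ε / 2)
    (fun u hu => ?_) (fun u hu => ?_) self_mem_Ici (show t + 1 ∈ Ici t by simp)
  · rw [dist_eq_norm]
    calc ‖f (t + 1) - f t - v‖ = ‖f (t + 1) - (t + 1) • v - (f t - t • v)‖ := by
          congr 1; module
      _ ≤ ε / 2 := by simpa only [add_sub_cancel_left, norm_one, mul_one] using hbound
      _ < ε := half_lt_self hε
  · have hlinear := (hasDerivAt_id u).smul_const v
    rw [one_smul] at hlinear
    exact ((hf u (ht0.trans_le hu)).sub hlinear).hasDerivWithinAt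
  · rw [← dist_eq_norm]
    exact (hT u (htT.trans hu)).le

theorem eq_zero_of_tendsto (hφ : Continuous φ) (hx : ∀ a, IsSolution φ x₀ a x) {y : X}
    (hy : Tendsto x atTop (𝓝 y)) : φ y = 0 :=
  eq_zero_of_tendsto_of_tendsto_deriv
    (fun t ht => (hx (t + 1)).hasDerivAt ⟨ht, lt_add_one t⟩) hy ((hφ.tendsto y).comp hy)

end CauchyProblem

section Invariance

theorem le_mul_infDist_add {X : Type*} [PseudoMetricSpace X] {K : Set X} (hK : K.Nonempty)
    {x : X} {a m n : ℝ} (hm : 0 < m)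
    (h : ∀ y ∈ K, a ≤ m * dist x y + n) : a ≤ m * Metric.infDist x K + n := by
  have : (a - n) / m ≤ Metric.infDist x K := (Metric.le_infDist hK).mpr fun y hy => by
    rw [div_le_iff₀' hm]
    linarith [h y hy]
  linarith [(div_le_iff₀' hm).mp this]

variable {X : Type*} [NormedAddCommGroup X] [NormedSpace ℝ X]

theorem mem_of_infDist_add_smul_le {K : Set X} (hK : IsClosed K) {Z V : ℝ → X} {b c : ℝ}
    (hZ : ContinuousOn Z (Icc 0 b)) (h0 : Z 0 ∈ K)
    (hV : ∀ t ∈ Ico 0 b, HasDerivWithinAt Z (V t) (Ici t) t)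
    (hstep : ∀ t ∈ Ico 0 b, ∃ B, ∀ h > 0, Metric.infDist (Z t + h • V t) K ≤
      (1 + c * h) * Metric.infDist (Z t) K + B * h ^ 2) :
    ∀ t ∈ Icc 0 b, Z t ∈ K := by
  intro t ht
  have hgronwall : Metric.infDist (Z t) K ≤ gronwallBound 0 c 0 (t - 0) := by
    refine le_gronwallBound_of_liminf_deriv_right_le
      (f' := fun t => c * Metric.infDist (Z t) K)
      ((Metric.continuous_infDist_pt K).comp_continuousOn hZ) (fun t ht ρ hρ => ?_)
      (Metric.infDist_zero_of_mem h0).le (fun t _ => (add_zero _).ge) t ht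
    obtain ⟨B, hB⟩ := hstep t ht
    have hid : Tendsto (fun z => z) (𝓝[>] t) (𝓝 t) := tendsto_id.mono_left inf_le_left
    have hslope := (hasDerivWithinAt_iff_tendsto_slope' self_notMem_Ioi).mp
      ((hV t ht).mono Ioi_subset_Ici_self)
    have hlim : Tendsto (fun z => c * Metric.infDist (Z t) K + B * (z - t) + ‖slope Z t z - V t‖)
        (𝓝[>] t) (𝓝 (c * Metric.infDist (Z t) K + B * (t - t) + ‖V t - V t‖)) :=
      (((hid.sub_const t).const_mul B).const_add _).add (hslope.sub_const _).norm
    rw [sub_self, sub_self, mul_zero, norm_zero, add_zero, add_zero] at hlim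
    refine Eventually.frequently ?_
    filter_upwards [hlim.eventually_lt_const hρ, self_mem_nhdsWithin] with z hz (htz : t < z)
    have hpos : 0 < z - t := sub_pos.mpr htz
    have herror : dist (Z z) (Z t + (z - t) • V t) = (z - t) * ‖slope Z t z - V t‖ := by
      rw [dist_eq_norm, ← sub_sub, ← vsub_eq_sub (Z z), ← sub_smul_slope, ← smul_sub, norm_smul,
        Real.norm_of_nonneg hpos.le]
    refine lt_of_le_of_lt ((inv_mul_le_iff₀ hpos).mpr ?_) hz
    simp only [Function.comp_apply]
    linarith [hB (z - t) hpos, herror,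
      Metric.infDist_le_infDist_add_dist (s := K) (x := Z z) (y := Z t + (z - t) • V t)]
  rw [gronwallBound_ε0_δ0] at hgronwall
  exact (hK.mem_iff_infDist_zero ⟨_, h0⟩).mpr (le_antisymm hgronwall Metric.infDist_nonneg)

end Invariance

section ThompsonMetric

variable {X : Type*} [AddCommGroup X] [PartialOrder X] [Module ℝ X] {x y : X} {s t : ℝ}

/-- `x` and `y` are comparable elements of the positive cone, i.e. they belong to the same part.
This is where `thompsonDist` is a metric rather than a junk value. -/
def SamePart (x y : X) : Prop :=
  0 ≤ x ∧ 0 ≤ y ∧ (∃ c : ℝ, x ≤ c • y) ∧ ∃ c : ℝ, y ≤ c • x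

theorem SamePart.eq_zero_iff (h : SamePart x y) : x = 0 ↔ y = 0 := by
  obtain ⟨hx, hy, ⟨c, hc⟩, d, hd⟩ := h
  constructor
  · rintro rfl
    exact le_antisymm (by rwa [smul_zero] at hd) hy
  · rintro rfl
    exact le_antisymm (by rwa [smul_zero] at hc) hx

variable [IsOrderedAddMonoid X] [IsOrderedModule ℝ X] [TopologicalSpace X] [ContinuousSMul ℝ X]
  [OrderClosedTopology X]

theorem maxRatio_le_iff (hx : 0 < x) (hy : 0 ≤ y) (hxy : ∃ c : ℝ, x ≤ c • y) :
    maxRatio x y ≤ t ↔ x ≤ t • y := by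
  have hclosed : IsClosed {t : ℝ | x ≤ t • y} :=
    isClosed_le continuous_const (continuous_id.smul continuous_const)
  have hbdd : BddBelow {t : ℝ | x ≤ t • y} := ⟨0, fun t ht => by
    by_contra! hneg
    exact (hx.trans_le ht).not_ge (smul_nonpos_of_nonpos_of_nonneg hneg.le hy)⟩
  refine ⟨fun h => ?_, fun h => csInf_le hbdd h⟩
  exact (hclosed.csInf_mem hxy hbdd).trans (smul_le_smul_of_nonneg_right h hy)

theorem maxRatio_pos (hx : 0 < x) (hy : 0 ≤ y) (hxy : ∃ c : ℝ, x ≤ c • y) :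
    0 < maxRatio x y := by
  by_contra! h
  rw [maxRatio_le_iff hx hy hxy, zero_smul] at h
  exact hx.not_ge h

theorem SamePart.thompsonDist_le_iff_of_pos (h : SamePart x y) (hx : 0 < x) :
    thompsonDist x y ≤ s ↔ x ≤ Real.exp s • y ∧ y ≤ Real.exp s • x := by
  have hy : 0 < y := h.2.1.lt_of_ne' (h.eq_zero_iff.not.mp hx.ne')
  obtain ⟨-, -, hxy, hyx⟩ := h
  rw [thompsonDist, Real.log_le_iff_le_exp (lt_max_of_lt_left (maxRatio_pos hx hy.le hxy)),
    max_le_iff, maxRatio_le_iff hx hy.le hxy, maxRatio_le_iff hy hx.le hyx]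

theorem SamePart.thompsonDist_nonneg (h : SamePart x y) : 0 ≤ thompsonDist x y := by
  rcases h.1.eq_or_lt with rfl | hx
  · rw [h.eq_zero_iff.mp rfl]
    simp [thompsonDist, maxRatio]
  by_contra! hneg
  obtain ⟨hxy, hyx⟩ := (h.thompsonDist_le_iff_of_pos hx).mp le_rfl
  set k := Real.exp (thompsonDist x y)
  have hk0 : 0 ≤ k := Real.exp_nonneg _
  have hk1 : k < 1 := Real.exp_lt_one_iff.mpr hneg
  have hself : x ≤ (k * k) • x := by
    rw [mul_smul]
    exact hxy.trans (smul_le_smul_of_nonneg_left hyx hk0)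
  have := SMulPosMono.toSMulPosStrictMono (α := ℝ) (β := X)
  have hkk : k * k < 1 := mul_lt_one_of_nonneg_of_lt_one_left hk0 hk1 hk1.le
  exact hself.not_gt (smul_lt_of_lt_one_left hx hkk)

theorem SamePart.thompsonDist_le_iff (h : SamePart x y) (hs : 0 ≤ s) :
    thompsonDist x y ≤ s ↔ x ≤ Real.exp s • y ∧ y ≤ Real.exp s • x := by
  rcases h.1.eq_or_lt with rfl | hx
  · rw [h.eq_zero_iff.mp rfl]
    simpa [thompsonDist, maxRatio] using hs
  · exact h.thompsonDist_le_iff_of_pos hx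

theorem SamePart.eq_of_thompsonDist_le_zero (h : SamePart x y) (h0 : thompsonDist x y ≤ 0) :
    x = y := by
  simpa only [Real.exp_zero, one_smul, le_antisymm_iff] using (h.thompsonDist_le_iff le_rfl).mp h0

end ThompsonMetric

section SymmetricOperators

variable {𝕜 E : Type*} [RCLike 𝕜] [NormedAddCommGroup E] [InnerProductSpace 𝕜 E]
  [CompleteSpace E]

namespace SymOp

theorem coe_add (P Q : SymOp 𝕜 E) :
    ((P + Q : SymOp 𝕜 E) : E →L[𝕜] E) = (P : E →L[𝕜] E) + Q := rfl

theorem coe_sub (P Q : SymOp 𝕜 E) :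
    ((P - Q : SymOp 𝕜 E) : E →L[𝕜] E) = (P : E →L[𝕜] E) - Q := rfl

theorem coe_zero : ((0 : SymOp 𝕜 E) : E →L[𝕜] E) = 0 := rfl

theorem star_coe (P : SymOp 𝕜 E) : star (P : E →L[𝕜] E) = P :=
  selfAdjoint.mem_iff.mp P.2

theorem isSymmetric (P : SymOp 𝕜 E) : (P : E →L[𝕜] E).IsSymmetric :=
  ContinuousLinearMap.isSelfAdjoint_iff_isSymmetric.mp P.2

theorem isPositive_iff_nonneg (P : SymOp 𝕜 E) : (P : E →L[𝕜] E).IsPositive ↔ 0 ≤ P := by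
  rw [le_iff, coe_zero, sub_zero]

instance instCompleteSpace : CompleteSpace (SymOp 𝕜 E) :=
  (isClosed_eq continuous_star continuous_id : IsClosed {T : E →L[𝕜] E | star T = T})
    |>.completeSpace_coe

instance instIsOrderedAddMonoid : IsOrderedAddMonoid (SymOp 𝕜 E) where
  add_le_add_left P Q h R := by
    rwa [le_iff, coe_add, coe_add, add_sub_add_right_eq_sub]

instance instIsOrderedModule : IsOrderedModule ℝ (SymOp 𝕜 E) :=
  .of_smul_nonneg fun c hc P hP => by
    rw [← isPositive_iff_nonneg] at hP ⊢
    exact hP.smul_of_nonneg (RCLike.ofReal_nonneg.mpr hc)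

theorem reApplyInnerSelf_sub (P Q : SymOp 𝕜 E) (x : E) :
    (P - Q : SymOp 𝕜 E).val.reApplyInnerSelf x =
      P.val.reApplyInnerSelf x - Q.val.reApplyInnerSelf x := by
  simp [coe_sub, ContinuousLinearMap.reApplyInnerSelf_apply, inner_sub_left]

theorem reApplyInnerSelf_smul_one (c : ℝ) (x : E) :
    (c • (1 : SymOp 𝕜 E)).val.reApplyInnerSelf x = c * ‖x‖ ^ 2 := by
  simp [coe_smul, coe_one, ContinuousLinearMap.reApplyInnerSelf_apply, inner_smul_left]

theorem nonneg_iff_reApplyInnerSelf {P : SymOp 𝕜 E} :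
    0 ≤ P ↔ ∀ x, 0 ≤ P.val.reApplyInnerSelf x := by
  rw [← isPositive_iff_nonneg, ContinuousLinearMap.isPositive_def]
  exact and_iff_right P.isSymmetric

theorem le_iff_reApplyInnerSelf {P Q : SymOp 𝕜 E} :
    P ≤ Q ↔ ∀ x, P.val.reApplyInnerSelf x ≤ Q.val.reApplyInnerSelf x := by
  rw [← sub_nonneg, nonneg_iff_reApplyInnerSelf]
  simp only [reApplyInnerSelf_sub, sub_nonneg]

instance instOrderClosedTopology : OrderClosedTopology (SymOp 𝕜 E) where
  isClosed_le' := by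
    simp only [le_iff_reApplyInnerSelf, ContinuousLinearMap.reApplyInnerSelf_apply, ofPred_forall]
    have : Continuous fun P : SymOp 𝕜 E => (P : E →L[𝕜] E) := continuous_subtype_val
    exact isClosed_iInter fun x => isClosed_le (by fun_prop) (by fun_prop)

theorem abs_reApplyInnerSelf_le (P : SymOp 𝕜 E) (x : E) :
    |P.val.reApplyInnerSelf x| ≤ ‖P‖ * ‖x‖ ^ 2 :=
  calc |P.val.reApplyInnerSelf x| ≤ ‖⟪(P : E →L[𝕜] E) x, x⟫_𝕜‖ := RCLike.abs_re_le_norm _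
    _ ≤ ‖(P : E →L[𝕜] E) x‖ * ‖x‖ := norm_inner_le_norm _ _
    _ ≤ ‖P‖ * ‖x‖ * ‖x‖ := by gcongr; exact (P : E →L[𝕜] E).le_opNorm x
    _ = ‖P‖ * ‖x‖ ^ 2 := by ring

theorem le_norm_smul_one (P : SymOp 𝕜 E) : P ≤ ‖P‖ • (1 : SymOp 𝕜 E) :=
  le_iff_reApplyInnerSelf.mpr fun x => by
    rw [reApplyInnerSelf_smul_one]
    exact le_of_abs_le (abs_reApplyInnerSelf_le P x)

theorem norm_le_of_mem_Icc {P : SymOp 𝕜 E} {c : ℝ} (hc : 0 ≤ c)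
    (h : P ∈ Icc ((-c) • (1 : SymOp 𝕜 E)) (c • 1)) : ‖P‖ ≤ c := by
  rw [norm_def, ContinuousLinearMap.norm_eq_iSup_rayleighQuotient _ P.isSymmetric]
  refine ciSup_le fun x => ?_
  rw [ContinuousLinearMap.rayleighQuotient, abs_div, abs_of_nonneg (sq_nonneg ‖x‖)]
  refine div_le_of_le_mul₀ (sq_nonneg _) hc (abs_le.mpr ?_)
  rw [← neg_mul, ← reApplyInnerSelf_smul_one (𝕜 := 𝕜), ← reApplyInnerSelf_smul_one (𝕜 := 𝕜)]
  exact ⟨le_iff_reApplyInnerSelf.mp h.1 x, le_iff_reApplyInnerSelf.mp h.2 x⟩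

theorem one_nonneg : (0 : SymOp 𝕜 E) ≤ 1 :=
  (isPositive_iff_nonneg _).mp ContinuousLinearMap.isPositive_one

theorem norm_le_of_nonneg_of_le {P : SymOp 𝕜 E} {c : ℝ} (hc : 0 ≤ c) (h0 : 0 ≤ P)
    (h1 : P ≤ c • (1 : SymOp 𝕜 E)) : ‖P‖ ≤ c :=
  norm_le_of_mem_Icc hc
    ⟨(smul_nonpos_of_nonpos_of_nonneg (neg_nonpos.mpr hc) one_nonneg).trans h0, h1⟩

theorem isUnit_of_smul_one_le {P : SymOp 𝕜 E} {ε : ℝ} (hε : 0 < ε)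
    (h : ε • (1 : SymOp 𝕜 E) ≤ P) : IsUnit (P : E →L[𝕜] E) := by
  refine ContinuousLinearMap.isUnit_of_forall_le_norm_inner_map _ (c := ⟨ε, hε.le⟩) hε fun x => ?_
  calc ‖x‖ ^ 2 * ε ≤ P.val.reApplyInnerSelf x := by
        rw [mul_comm, ← reApplyInnerSelf_smul_one (𝕜 := 𝕜)]
        exact le_iff_reApplyInnerSelf.mp h x
    _ ≤ _ := RCLike.re_le_norm _

theorem norm_apply_sq_le_of_nonneg {P : SymOp 𝕜 E} (h : 0 ≤ P) (x : E) :
    ‖(P : E →L[𝕜] E) x‖ ^ 2 ≤ ‖P‖ * P.val.reApplyInnerSelf x := by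
  rcases eq_or_ne P 0 with rfl | hP
  · simp [coe_zero]
  have hnorm : 0 < ‖P‖ := norm_pos_iff.mpr hP
  set y := (P : E →L[𝕜] E) x
  have hexpand : P.val.reApplyInnerSelf ((‖P‖ : 𝕜) • x - y) =
      ‖P‖ ^ 2 * P.val.reApplyInnerSelf x - 2 * ‖P‖ * ‖y‖ ^ 2 + P.val.reApplyInnerSelf y := by
    have hsymm : ⟪(P : E →L[𝕜] E) y, x⟫_𝕜 = ⟪y, y⟫_𝕜 := P.isSymmetric y x
    have hy : (P : E →L[𝕜] E) x = y := rfl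
    simp only [ContinuousLinearMap.reApplyInnerSelf_apply, map_sub, map_smul, inner_sub_left,
      inner_sub_right, inner_smul_left, inner_smul_right, hy, RCLike.conj_ofReal, hsymm,
      RCLike.re_ofReal_mul, inner_self_eq_norm_sq]
    ring
  have hnonneg := nonneg_iff_reApplyInnerSelf.mp h ((‖P‖ : 𝕜) • x - y)
  refine le_of_mul_le_mul_left ?_ hnorm
  linarith [le_of_abs_le (abs_reApplyInnerSelf_le P y)]

theorem exists_smul_one_le_of_isUnit {P : SymOp 𝕜 E} (h : 0 ≤ P)
    (hu : IsUnit (P : E →L[𝕜] E)) : ∃ ε > (0 : ℝ), ε • (1 : SymOp 𝕜 E) ≤ P := by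
  obtain ⟨T, hT⟩ := hu.exists_left_inv
  refine ⟨(‖T‖ ^ 2 * ‖P‖ + 1)⁻¹, by positivity, le_iff_reApplyInnerSelf.mpr fun x => ?_⟩
  rw [reApplyInnerSelf_smul_one, inv_mul_le_iff₀ (by positivity)]
  have hx : T ((P : E →L[𝕜] E) x) = x := congrArg (fun f : E →L[𝕜] E => f x) hT
  have hq := nonneg_iff_reApplyInnerSelf.mp h x
  calc ‖x‖ ^ 2 ≤ (‖T‖ * ‖(P : E →L[𝕜] E) x‖) ^ 2 := by
        gcongr
        simpa only [hx] using T.le_opNorm ((P : E →L[𝕜] E) x)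
    _ = ‖T‖ ^ 2 * ‖(P : E →L[𝕜] E) x‖ ^ 2 := mul_pow _ _ _
    _ ≤ ‖T‖ ^ 2 * (‖P‖ * P.val.reApplyInnerSelf x) := by
      gcongr
      exact norm_apply_sq_le_of_nonneg h x
    _ ≤ (‖T‖ ^ 2 * ‖P‖ + 1) * P.val.reApplyInnerSelf x := by linarith

end SymOp

theorem mem_posUpTo_iff {P : SymOp 𝕜 E} {r : ℝ} :
    P ∈ posUpTo 𝕜 E r ↔ (∃ ε > (0 : ℝ), ε • (1 : SymOp 𝕜 E) ≤ P) ∧ P ≤ r • (1 : SymOp 𝕜 E) := by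
  constructor
  · rintro ⟨hpos, hunit, hle⟩
    exact ⟨SymOp.exists_smul_one_le_of_isUnit ((SymOp.isPositive_iff_nonneg P).mp hpos) hunit, hle⟩
  · rintro ⟨⟨ε, hε, hP⟩, hle⟩
    exact ⟨(SymOp.isPositive_iff_nonneg P).mpr ((smul_nonneg hε.le SymOp.one_nonneg).trans hP),
      SymOp.isUnit_of_smul_one_le hε hP, hle⟩

theorem star_ofReal_smul (c : ℝ) (T : E →L[𝕜] E) : star ((c : 𝕜) • T) = (c : 𝕜) • star T := by
  rw [star_smul, RCLike.star_def, RCLike.conj_ofReal]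

/-- The congruence `W ↦ T' W T`, as a linear map on the symmetric operators. -/
def congruence (T : E →L[𝕜] E) : SymOp 𝕜 E →ₗ[ℝ] SymOp 𝕜 E where
  toFun W := ⟨star T * (W : E →L[𝕜] E) * T, by
    rw [selfAdjoint.mem_iff, star_mul, star_mul, star_star, W.star_coe, mul_assoc]⟩
  map_add' V W := Subtype.ext <| by
    change star T * ((V : E →L[𝕜] E) + W) * T = star T * V * T + star T * W * T
    rw [mul_add, add_mul]
  map_smul' c W := Subtype.ext <| by
    change star T * ((c : 𝕜) • (W : E →L[𝕜] E)) * T = (c : 𝕜) • (star T * W * T)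
    rw [mul_smul_comm, smul_mul_assoc]

/-- The Lyapunov operator `W ↦ R' W + W R`, as a linear map on the symmetric operators. -/
def lyapunov (R : E →L[𝕜] E) : SymOp 𝕜 E →ₗ[ℝ] SymOp 𝕜 E where
  toFun W := ⟨star R * (W : E →L[𝕜] E) + (W : E →L[𝕜] E) * R, by
    rw [selfAdjoint.mem_iff, star_add, star_mul, star_mul, star_star, W.star_coe, add_comm]⟩
  map_add' V W := Subtype.ext <| by
    change star R * ((V : E →L[𝕜] E) + W) + (V + W) * R = star R * V + V * R + (star R * W + W * R)
    rw [mul_add, add_mul, add_add_add_comm]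
  map_smul' c W := Subtype.ext <| by
    change star R * ((c : 𝕜) • (W : E →L[𝕜] E)) + (c : 𝕜) • (W : E →L[𝕜] E) * R =
      (c : 𝕜) • (star R * W + W * R)
    rw [mul_smul_comm, smul_mul_assoc, smul_add]

theorem coe_congruence (T : E →L[𝕜] E) (W : SymOp 𝕜 E) :
    (congruence T W : E →L[𝕜] E) = star T * (W : E →L[𝕜] E) * T := rfl

theorem coe_lyapunov (R : E →L[𝕜] E) (W : SymOp 𝕜 E) :
    (lyapunov R W : E →L[𝕜] E) = star R * (W : E →L[𝕜] E) + (W : E →L[𝕜] E) * R := rfl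

theorem coe_riccatiField (A : E →L[𝕜] E) (D S P : SymOp 𝕜 E) :
    (riccatiField A D S P : E →L[𝕜] E) = star A * (P : E →L[𝕜] E) + (P : E →L[𝕜] E) * A
      + (D : E →L[𝕜] E) - (P : E →L[𝕜] E) * (S : E →L[𝕜] E) * (P : E →L[𝕜] E) := rfl

theorem riccatiField_eq_zero_iff (A : E →L[𝕜] E) (D S P : SymOp 𝕜 E) :
    riccatiField A D S P = 0 ↔ SolvesARE A D S P := Subtype.ext_iff

theorem riccatiField_eq (A : E →L[𝕜] E) (D S P : SymOp 𝕜 E) :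
    riccatiField A D S P = lyapunov A P + D - congruence (P : E →L[𝕜] E) S :=
  Subtype.ext <| by
    simp only [coe_riccatiField, SymOp.coe_sub, SymOp.coe_add, coe_lyapunov, coe_congruence,
      P.star_coe]

theorem riccatiField_zero (A : E →L[𝕜] E) (D S : SymOp 𝕜 E) : riccatiField A D S 0 = D :=
  Subtype.ext <| by simp [coe_riccatiField, SymOp.coe_zero]

theorem riccatiField_smul (A : E →L[𝕜] E) (D S P : SymOp 𝕜 E) (c : ℝ) :
    riccatiField A D S (c • P) =
      c • riccatiField A D S P + (1 - c) • (D + c • congruence (P : E →L[𝕜] E) S) := by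
  have hcongr : congruence ((c • P : SymOp 𝕜 E) : E →L[𝕜] E) S =
      c ^ 2 • congruence (P : E →L[𝕜] E) S := Subtype.ext <| by
    simp only [coe_congruence, SymOp.coe_smul, star_ofReal_smul, smul_mul_assoc, mul_smul_comm,
      smul_smul, pow_two, RCLike.ofReal_mul]
  rw [riccatiField_eq, riccatiField_eq, hcongr, map_smul]
  module

theorem congruence_nonneg (T : E →L[𝕜] E) {W : SymOp 𝕜 E} (h : 0 ≤ W) : 0 ≤ congruence T W := by
  rw [← SymOp.isPositive_iff_nonneg] at h ⊢
  exact h.adjoint_conj T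

theorem congruence_mono (T : E →L[𝕜] E) {V W : SymOp 𝕜 E} (h : V ≤ W) :
    congruence T V ≤ congruence T W := by
  rw [← sub_nonneg] at h ⊢
  rw [← map_sub]
  exact congruence_nonneg T h

theorem norm_star_op (T : E →L[𝕜] E) : ‖star T‖ = ‖T‖ :=
  LinearIsometryEquiv.norm_map ContinuousLinearMap.adjoint T

theorem norm_congruence_le (T : E →L[𝕜] E) (W : SymOp 𝕜 E) :
    ‖congruence T W‖ ≤ ‖T‖ ^ 2 * ‖W‖ :=
  calc ‖star T * (W : E →L[𝕜] E) * T‖ ≤ ‖star T‖ * ‖W‖ * ‖T‖ := norm_mul₃_le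
    _ = ‖T‖ ^ 2 * ‖W‖ := by rw [norm_star_op]; ring

theorem neg_smul_one_le_congruence {S : SymOp 𝕜 E} {k : ℝ} (hk : 0 ≤ k)
    (hS : (-k) • (1 : SymOp 𝕜 E) ≤ S) (T : E →L[𝕜] E) :
    (-(k * ‖T‖ ^ 2)) • (1 : SymOp 𝕜 E) ≤ congruence T S := by
  have hone : congruence T 1 ≤ ‖T‖ ^ 2 • (1 : SymOp 𝕜 E) :=
    (SymOp.le_norm_smul_one _).trans <| smul_le_smul_of_nonneg_right
      ((norm_congruence_le T 1).trans
        (mul_le_of_le_one_right (sq_nonneg _) ContinuousLinearMap.norm_id_le))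
      SymOp.one_nonneg
  calc (-(k * ‖T‖ ^ 2)) • (1 : SymOp 𝕜 E) = (-k) • ‖T‖ ^ 2 • (1 : SymOp 𝕜 E) := by
        rw [smul_smul, neg_mul]
    _ ≤ (-k) • congruence T 1 := smul_le_smul_of_nonpos_left hone (neg_nonpos.mpr hk)
    _ = congruence T ((-k) • 1) := (map_smul _ _ _).symm
    _ ≤ congruence T S := congruence_mono T hS

theorem norm_lyapunov_le (R : E →L[𝕜] E) (W : SymOp 𝕜 E) :
    ‖lyapunov R W‖ ≤ 2 * ‖R‖ * ‖W‖ :=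
  calc ‖star R * (W : E →L[𝕜] E) + (W : E →L[𝕜] E) * R‖ ≤ ‖star R‖ * ‖W‖ + ‖W‖ * ‖R‖ :=
        (norm_add_le _ _).trans (add_le_add (norm_mul_le _ _) (norm_mul_le _ _))
    _ = 2 * ‖R‖ * ‖W‖ := by rw [norm_star_op]; ring

theorem congruence_one_add_smul (h : ℝ) (R : E →L[𝕜] E) (W : SymOp 𝕜 E) :
    congruence (1 + (h : 𝕜) • R) W = W + h • lyapunov R W + h ^ 2 • congruence R W :=
  Subtype.ext <| by
    simp only [coe_congruence, coe_lyapunov, SymOp.coe_add, SymOp.coe_smul, star_add, star_one,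
      star_ofReal_smul, add_mul, mul_add, smul_mul_assoc, mul_smul_comm, one_mul, mul_one,
      smul_add, smul_smul, RCLike.ofReal_mul, pow_two]
    abel

/-- The closed-loop operator `A - S (P + Q) / 2`, whose Lyapunov operator propagates the
difference of two solutions `P`, `Q` of the Riccati equation. -/
def closedLoop (A : E →L[𝕜] E) (S P Q : SymOp 𝕜 E) : E →L[𝕜] E :=
  A - ((1 / 2 : ℝ) : 𝕜) • ((S : E →L[𝕜] E) * ((P : E →L[𝕜] E) + Q))

theorem norm_closedLoop_le (A : E →L[𝕜] E) (S P Q : SymOp 𝕜 E) :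
    ‖closedLoop A S P Q‖ ≤ ‖A‖ + ‖S‖ * (‖P‖ + ‖Q‖) := by
  refine (norm_sub_le _ _).trans (add_le_add_right ?_ _)
  rw [norm_smul, RCLike.norm_ofReal, abs_of_pos one_half_pos]
  have hmul : ‖(S : E →L[𝕜] E) * ((P : E →L[𝕜] E) + Q)‖ ≤ ‖S‖ * (‖P‖ + ‖Q‖) :=
    (norm_mul_le _ _).trans (mul_le_mul_of_nonneg_left (norm_add_le _ _) (norm_nonneg _))
  linarith [norm_nonneg ((S : E →L[𝕜] E) * ((P : E →L[𝕜] E) + Q))]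

theorem riccatiField_sub (A : E →L[𝕜] E) (D S P Q : SymOp 𝕜 E) :
    riccatiField A D S P - riccatiField A D S Q = lyapunov (closedLoop A S P Q) (P - Q) := by
  refine Subtype.ext ?_
  simp only [SymOp.coe_sub, coe_riccatiField, coe_lyapunov, closedLoop, star_sub,
    star_ofReal_smul, star_mul, star_add, P.star_coe, Q.star_coe, S.star_coe]
  generalize (P : E →L[𝕜] E) = p
  generalize (Q : E →L[𝕜] E) = q
  generalize (S : E →L[𝕜] E) = s
  have hpolar : p * s * p - q * s * q =
      ((1 / 2 : ℝ) : 𝕜) • ((p + q) * s * (p - q) + (p - q) * s * (p + q)) := by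
    have hhalves : ((1 / 2 : ℝ) : 𝕜) + ((1 / 2 : ℝ) : 𝕜) = 1 := by
      rw [← RCLike.ofReal_add, add_halves, RCLike.ofReal_one]
    rw [← one_smul 𝕜 (p * s * p - q * s * q), ← hhalves, add_smul, ← smul_add]
    congr 1
    noncomm_ring
  rw [sub_mul, mul_sub (p - q) A, smul_mul_assoc, mul_smul_comm, ← mul_assoc (p - q) s]
  rw [smul_add, sub_eq_iff_eq_add] at hpolar
  rw [hpolar]
  noncomm_ring

end SymmetricOperators

section Comparison

variable {𝕜 E : Type*} [RCLike 𝕜] [NormedAddCommGroup E] [InnerProductSpace 𝕜 E]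
  [CompleteSpace E]

/- Up to second order in `h`, the Euler step `Z + h (R' Z + Z R)` is the congruence of `Z` by
`1 + h R`, and congruences preserve the positive cone. -/
theorem infDist_add_smul_lyapunov_le {Z F : SymOp 𝕜 E} {R : E →L[𝕜] E} {L h : ℝ} (hR : ‖R‖ ≤ L)
    (hF : 0 ≤ F) (hh : 0 ≤ h) :
    Metric.infDist (Z + h • (lyapunov R Z + F)) (Ici 0) ≤
      (1 + h * L) ^ 2 * Metric.infDist Z (Ici 0) + h ^ 2 * (L ^ 2 * ‖Z‖) := by
  have hL : 0 ≤ L := (norm_nonneg R).trans hR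
  set T : E →L[𝕜] E := 1 + (h : 𝕜) • R with hT
  have hTnorm : ‖T‖ ≤ 1 + h * L := by
    refine (norm_add_le _ _).trans (add_le_add ContinuousLinearMap.norm_id_le ?_)
    rw [norm_smul, RCLike.norm_ofReal, abs_of_nonneg hh]
    gcongr
  refine le_mul_infDist_add ⟨0, self_mem_Ici⟩ (by positivity) fun C hC => ?_
  have hmem : congruence T C + h • F ∈ Ici (0 : SymOp 𝕜 E) :=
    add_nonneg (congruence_nonneg T hC) (smul_nonneg hh hF)
  have hdiff : Z + h • (lyapunov R Z + F) - (congruence T C + h • F) =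
      congruence T (Z - C) - h ^ 2 • congruence R Z := by
    rw [map_sub, hT, congruence_one_add_smul h R Z]
    module
  calc Metric.infDist (Z + h • (lyapunov R Z + F)) (Ici 0)
    _ ≤ ‖congruence T (Z - C) - h ^ 2 • congruence R Z‖ := by
        rw [← hdiff, ← dist_eq_norm]
        exact Metric.infDist_le_dist_of_mem hmem
    _ ≤ ‖T‖ ^ 2 * ‖Z - C‖ + h ^ 2 * (‖R‖ ^ 2 * ‖Z‖) := by
        refine (norm_sub_le _ _).trans (add_le_add (norm_congruence_le _ _) ?_)
        rw [norm_smul, Real.norm_of_nonneg (sq_nonneg h)]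
        gcongr
        exact norm_congruence_le R Z
    _ ≤ (1 + h * L) ^ 2 * dist Z C + h ^ 2 * (L ^ 2 * ‖Z‖) := by
        rw [dist_eq_norm]
        gcongr

theorem nonneg_of_hasDerivWithinAt_lyapunov {Z F : ℝ → SymOp 𝕜 E} {R : ℝ → E →L[𝕜] E} {b L : ℝ}
    (hZ : ContinuousOn Z (Icc 0 b))
    (hZ' : ∀ t ∈ Ico 0 b, HasDerivWithinAt Z (lyapunov (R t) (Z t) + F t) (Ici t) t)
    (hR : ∀ t ∈ Ico 0 b, ‖R t‖ ≤ L) (hF : ∀ t ∈ Ico 0 b, 0 ≤ F t) (h0 : 0 ≤ Z 0) :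
    ∀ t ∈ Icc 0 b, 0 ≤ Z t :=
  mem_of_infDist_add_smul_le (K := Ici (0 : SymOp 𝕜 E)) (c := 2 * L) isClosed_Ici hZ h0 hZ'
    fun t ht => ⟨L ^ 2 * (Metric.infDist (Z t) (Ici 0) + ‖Z t‖), fun h hh =>
      (infDist_add_smul_lyapunov_le (hR t ht) (hF t ht) hh.le).trans_eq (by ring)⟩

theorem riccati_comparison {A : E →L[𝕜] E} {D S : SymOp 𝕜 E} {x y x' y' : ℝ → SymOp 𝕜 E} {b : ℝ}
    (hx : ContinuousOn x (Icc 0 b)) (hy : ContinuousOn y (Icc 0 b))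
    (hx' : ∀ t ∈ Ico 0 b, HasDerivWithinAt x (x' t) (Ici t) t)
    (hy' : ∀ t ∈ Ico 0 b, HasDerivWithinAt y (y' t) (Ici t) t)
    (hsub : ∀ t ∈ Ico 0 b, x' t ≤ riccatiField A D S (x t))
    (hsuper : ∀ t ∈ Ico 0 b, riccatiField A D S (y t) ≤ y' t) (h0 : x 0 ≤ y 0) :
    ∀ t ∈ Icc 0 b, x t ≤ y t := by
  obtain ⟨Cx, hCx⟩ := isCompact_Icc.exists_bound_of_continuousOn hx
  obtain ⟨Cy, hCy⟩ := isCompact_Icc.exists_bound_of_continuousOn hy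
  intro t ht
  refine sub_nonneg.mp <| nonneg_of_hasDerivWithinAt_lyapunov (Z := fun t => y t - x t)
    (R := fun t => closedLoop A S (y t) (x t))
    (F := fun t => y' t - riccatiField A D S (y t) + (riccatiField A D S (x t) - x' t))
    (L := ‖A‖ + ‖S‖ * (Cy + Cx)) (hy.sub hx) (fun u hu => ?_) (fun u hu => ?_) (fun u hu => ?_)
    (sub_nonneg.mpr h0) t ht
  · refine ((hy' u hu).sub (hx' u hu)).congr_deriv ?_
    rw [← riccatiField_sub A D]
    abel
  · refine (norm_closedLoop_le A S (y u) (x u)).trans ?_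
    gcongr
    exacts [hCy u (Ico_subset_Icc_self hu), hCx u (Ico_subset_Icc_self hu)]
  · exact add_nonneg (sub_nonneg.mpr (hsuper u hu)) (sub_nonneg.mpr (hsub u hu))

variable {A : E →L[𝕜] E} {D S P U V : SymOp 𝕜 E} {x : ℝ → SymOp 𝕜 E} {a t : ℝ}

theorem IsSolution.mem_Icc (h : IsSolution (riccatiField A D S) P a x)
    (hU : 0 ≤ riccatiField A D S U) (hV : riccatiField A D S V ≤ 0) (hP : P ∈ Icc U V)
    (ht : t ∈ Ico 0 a) : x t ∈ Icc U V := by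
  have hx := h.continuousOn_Icc ht.2
  have hx' : ∀ u ∈ Ico 0 t, HasDerivWithinAt x (riccatiField A D S (x u)) (Ici u) u :=
    fun u hu => h.hasDerivWithinAt_Ici ⟨hu.1, hu.2.trans ht.2⟩
  have hend : t ∈ Icc 0 t := ⟨ht.1, le_rfl⟩
  constructor
  · exact riccati_comparison continuousOn_const hx (fun u _ => hasDerivWithinAt_const u _ U) hx'
      (fun _ _ => hU) (fun _ _ => le_rfl) (h.1 ▸ hP.1) t hend
  · exact riccati_comparison hx continuousOn_const hx' (fun u _ => hasDerivWithinAt_const u _ V)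
      (fun _ _ => le_rfl) (fun _ _ => hV) (h.1 ▸ hP.2) t hend

theorem lipschitzOnBounded_riccatiField (A : E →L[𝕜] E) (D S : SymOp 𝕜 E) :
    LipschitzOnBounded (riccatiField A D S) := fun ρ => by
  refine ⟨(2 * (‖A‖ + ‖S‖ * (ρ + ρ))).toNNReal, .of_dist_le' fun P hP Q hQ => ?_⟩
  rw [mem_closedBall_zero_iff] at hP hQ
  rw [dist_eq_norm, dist_eq_norm, riccatiField_sub]
  refine (norm_lyapunov_le _ _).trans ?_
  gcongr
  refine (norm_closedLoop_le A S P Q).trans ?_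
  gcongr

theorem isSolution_flow_riccatiField {ρ : ℝ} (hD : 0 ≤ D) (hρ : 0 ≤ ρ)
    (hV : riccatiField A D S (ρ • (1 : SymOp 𝕜 E)) ≤ 0)
    (hP : P ∈ Icc 0 (ρ • (1 : SymOp 𝕜 E))) (a : ℝ) :
    IsSolution (riccatiField A D S) P a fun t => flow (riccatiField A D S) t P :=
  have hφ := lipschitzOnBounded_riccatiField A D S
  isSolution_flow hφ (exists_isSolution_of_forall_norm_le hφ fun _ _ hx _ ht =>
    have hmem := hx.mem_Icc ((riccatiField_zero A D S).symm ▸ hD) hV hP ht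
    SymOp.norm_le_of_nonneg_of_le hρ hmem.1 hmem.2) a

end Comparison

section Contraction

variable {𝕜 E : Type*} [RCLike 𝕜] [NormedAddCommGroup E] [InnerProductSpace 𝕜 E]
  [CompleteSpace E] {A : E →L[𝕜] E} {D S P Q : SymOp 𝕜 E} {m k r α : ℝ}

theorem smul_riccatiField_add_le (hD : m • (1 : SymOp 𝕜 E) ≤ D) (hk : 0 ≤ k)
    (hS : (-k) • (1 : SymOp 𝕜 E) ≤ S) (hr : 0 ≤ r) (hP : P ∈ Icc 0 (r • (1 : SymOp 𝕜 E))) {c : ℝ}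
    (hc : c ∈ Icc (0 : ℝ) 1) :
    c • riccatiField A D S P + ((1 - c) * (m - k * r ^ 2)) • (1 : SymOp 𝕜 E) ≤
      riccatiField A D S (c • P) := by
  rw [riccatiField_smul, mul_smul]
  refine add_le_add_right (smul_le_smul_of_nonneg_left ?_ (sub_nonneg.mpr hc.2)) _
  have hnorm : ‖P‖ ≤ r := SymOp.norm_le_of_nonneg_of_le hr hP.1 hP.2
  have hscalar : c * (k * ‖P‖ ^ 2) ≤ k * r ^ 2 :=
    calc c * (k * ‖P‖ ^ 2) ≤ 1 * (k * r ^ 2) := by gcongr; exact hc.2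
      _ = k * r ^ 2 := one_mul _
  calc (m - k * r ^ 2) • (1 : SymOp 𝕜 E)
    _ ≤ (m - c * (k * ‖P‖ ^ 2)) • 1 :=
        smul_le_smul_of_nonneg_right (by linarith) SymOp.one_nonneg
    _ = m • 1 + c • (-(k * ‖P‖ ^ 2)) • 1 := by module
    _ ≤ D + c • congruence (P : E →L[𝕜] E) S :=
        add_le_add hD (smul_le_smul_of_nonneg_left (neg_smul_one_le_congruence hk hS _) hc.1)

theorem exp_neg_smul_riccatiField_add_le (hD : m • (1 : SymOp 𝕜 E) ≤ D) (hk : 0 ≤ k)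
    (hS : (-k) • (1 : SymOp 𝕜 E) ≤ S) (hr : 0 ≤ r) (hα : 0 ≤ α) (hαr : α * r ≤ m - k * r ^ 2)
    (hP : P ∈ Icc 0 (r • (1 : SymOp 𝕜 E))) {w : ℝ} (hw : 0 ≤ w) :
    Real.exp (-w) • riccatiField A D S P + (Real.exp (-w) * (α * w)) • P ≤
      riccatiField A D S (Real.exp (-w) • P) := by
  have hexp : Real.exp (-w) * w ≤ 1 - Real.exp (-w) := by
    have : Real.exp (-w) * (w + 1) ≤ Real.exp (-w) * Real.exp w := by
      gcongr
      exact Real.add_one_le_exp w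
    rw [← Real.exp_add, neg_add_cancel, Real.exp_zero] at this
    linarith
  have hrate : Real.exp (-w) * (α * w) * r ≤ (1 - Real.exp (-w)) * (m - k * r ^ 2) :=
    calc Real.exp (-w) * (α * w) * r = Real.exp (-w) * w * (α * r) := by ring
      _ ≤ (1 - Real.exp (-w)) * (m - k * r ^ 2) := by
        have : 0 ≤ Real.exp (-w) * w := by positivity
        gcongr
        exact this.trans hexp
  have hw1 : Real.exp (-w) ≤ 1 := Real.exp_le_one_iff.mpr (neg_nonpos.mpr hw)
  refine le_trans (add_le_add_right ?_ _)
    (smul_riccatiField_add_le hD hk hS hr hP ⟨Real.exp_nonneg _, hw1⟩)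
  calc (Real.exp (-w) * (α * w)) • P ≤ (Real.exp (-w) * (α * w)) • r • (1 : SymOp 𝕜 E) :=
        smul_le_smul_of_nonneg_left hP.2 (by positivity)
    _ = (Real.exp (-w) * (α * w) * r) • 1 := smul_smul _ _ _
    _ ≤ ((1 - Real.exp (-w)) * (m - k * r ^ 2)) • 1 :=
        smul_le_smul_of_nonneg_right hrate SymOp.one_nonneg

theorem hasDerivAt_exp_neg_exp (α s t : ℝ) :
    HasDerivAt (fun u => Real.exp (-(Real.exp (-α * u) * s)))
      (Real.exp (-(Real.exp (-α * t) * s)) * (α * (Real.exp (-α * t) * s))) t := by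
  have h := (((hasDerivAt_id t).const_mul (-α)).exp.mul_const s).fun_neg.exp
  exact h.congr_deriv (by simp only [id]; ring)

theorem IsSolution.le_exp_smul {x y : ℝ → SymOp 𝕜 E} {a s t : ℝ}
    (hx : IsSolution (riccatiField A D S) P a x) (hy : IsSolution (riccatiField A D S) Q a y)
    (hD : m • (1 : SymOp 𝕜 E) ≤ D) (hk : 0 ≤ k) (hS : (-k) • (1 : SymOp 𝕜 E) ≤ S) (hr : 0 ≤ r)
    (hα : 0 ≤ α) (hαr : α * r ≤ m - k * r ^ 2)
    (hxr : ∀ u ∈ Ico 0 a, x u ∈ Icc 0 (r • (1 : SymOp 𝕜 E)))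
    (hs : 0 ≤ s) (hPQ : P ≤ Real.exp s • Q) (ht : t ∈ Ico 0 a) :
    x t ≤ Real.exp (Real.exp (-α * t) * s) • y t := by
  set ν : ℝ → ℝ := fun u => Real.exp (-(Real.exp (-α * u) * s))
  have hν : Continuous ν := by fun_prop
  have hIco : ∀ u ∈ Ico 0 t, u ∈ Ico 0 a := fun u hu => ⟨hu.1, hu.2.trans ht.2⟩
  have hcompare : ν t • x t ≤ y t := by
    refine riccati_comparison (hν.continuousOn.smul (hx.continuousOn_Icc ht.2))
      (hy.continuousOn_Icc ht.2)
      (fun u hu => (hasDerivAt_exp_neg_exp α s u).hasDerivWithinAt.smul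
        (hx.hasDerivWithinAt_Ici (hIco u hu)))
      (fun u hu => hy.hasDerivWithinAt_Ici (hIco u hu))
      (fun u hu => exp_neg_smul_riccatiField_add_le hD hk hS hr hα hαr (hxr u (hIco u hu))
        (mul_nonneg (Real.exp_nonneg _) hs))
      (fun _ _ => le_rfl) ?_ t ⟨ht.1, le_rfl⟩
    change Real.exp (-(Real.exp (-α * 0) * s)) • x 0 ≤ y 0
    rw [mul_zero, Real.exp_zero, one_mul, Real.exp_neg, hx.1, hy.1]
    exact (inv_smul_le_iff_of_pos (Real.exp_pos s)).mpr hPQ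
  refine (inv_smul_le_iff_of_pos (Real.exp_pos _)).mp ?_
  rw [← Real.exp_neg]
  exact hcompare

end Contraction

section Equilibrium

variable {𝕜 E : Type*} [RCLike 𝕜] [NormedAddCommGroup E] [InnerProductSpace 𝕜 E]
  [CompleteSpace E] {A : E →L[𝕜] E} {D S P Q : SymOp 𝕜 E} {m k r α ε t : ℝ}

theorem SymOp.le_div_smul_of_smul_one_le (hε : 0 < ε) (hr : 0 ≤ r)
    (hP : P ≤ r • (1 : SymOp 𝕜 E)) (hQ : ε • (1 : SymOp 𝕜 E) ≤ Q) : P ≤ (r / ε) • Q :=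
  calc P ≤ r • (1 : SymOp 𝕜 E) := hP
    _ = (r / ε) • ε • 1 := by rw [smul_smul, div_mul_cancel₀ r hε.ne']
    _ ≤ (r / ε) • Q := smul_le_smul_of_nonneg_left hQ (by positivity)

theorem nonneg_of_mem_posUpTo (hP : P ∈ posUpTo 𝕜 E r) : 0 ≤ P :=
  (SymOp.isPositive_iff_nonneg P).mp hP.1

theorem mem_Icc_of_mem_posUpTo (hP : P ∈ posUpTo 𝕜 E r) : P ∈ Icc 0 (r • (1 : SymOp 𝕜 E)) :=
  ⟨nonneg_of_mem_posUpTo hP, hP.2.2⟩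

theorem samePart_of_mem_posUpTo (hr : 0 ≤ r) (hP : P ∈ posUpTo 𝕜 E r)
    (hQ : Q ∈ posUpTo 𝕜 E r) : SamePart P Q := by
  obtain ⟨⟨ε, hε, hεP⟩, hPr⟩ := mem_posUpTo_iff.mp hP
  obtain ⟨⟨δ, hδ, hδQ⟩, hQr⟩ := mem_posUpTo_iff.mp hQ
  exact ⟨nonneg_of_mem_posUpTo hP, nonneg_of_mem_posUpTo hQ,
    ⟨_, SymOp.le_div_smul_of_smul_one_le hδ hr hPr hδQ⟩,
    ⟨_, SymOp.le_div_smul_of_smul_one_le hε hr hQr hεP⟩⟩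

theorem mem_posUpTo_of_mem_Icc (hε : 0 < ε)
    (hP : P ∈ Icc (ε • (1 : SymOp 𝕜 E)) (r • (1 : SymOp 𝕜 E))) : P ∈ posUpTo 𝕜 E r :=
  mem_posUpTo_iff.mpr ⟨⟨ε, hε, hP.1⟩, hP.2⟩

theorem thompsonDist_le_log_div (hε : 0 < ε) (hεr : ε ≤ r)
    (hP : P ∈ Icc (ε • (1 : SymOp 𝕜 E)) (r • (1 : SymOp 𝕜 E)))
    (hQ : Q ∈ Icc (ε • (1 : SymOp 𝕜 E)) (r • (1 : SymOp 𝕜 E))) :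
    thompsonDist P Q ≤ Real.log (r / ε) := by
  have hr : 0 < r := hε.trans_le hεr
  have hPQ := samePart_of_mem_posUpTo hr.le (mem_posUpTo_of_mem_Icc hε hP)
    (mem_posUpTo_of_mem_Icc hε hQ)
  rw [hPQ.thompsonDist_le_iff (Real.log_nonneg ((one_le_div hε).mpr hεr)),
    Real.exp_log (div_pos hr hε)]
  exact ⟨SymOp.le_div_smul_of_smul_one_le hε hr.le hP.2 hQ.1,
    SymOp.le_div_smul_of_smul_one_le hε hr.le hQ.2 hP.1⟩

theorem SamePart.norm_sub_le (h : SamePart P Q) (hr : 0 ≤ r) (hP : P ≤ r • (1 : SymOp 𝕜 E))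
    (hQ : Q ≤ r • (1 : SymOp 𝕜 E)) : ‖P - Q‖ ≤ (Real.exp (thompsonDist P Q) - 1) * r := by
  obtain ⟨hPQ, hQP⟩ := (h.thompsonDist_le_iff h.thompsonDist_nonneg).mp le_rfl
  set c := Real.exp (thompsonDist P Q)
  have hc : 0 ≤ c - 1 := sub_nonneg.mpr (Real.one_le_exp h.thompsonDist_nonneg)
  have hbound : ∀ X Y : SymOp 𝕜 E, X ≤ c • Y → Y ≤ r • (1 : SymOp 𝕜 E) →
      X - Y ≤ ((c - 1) * r) • (1 : SymOp 𝕜 E) := fun X Y hXY hY =>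
    calc X - Y ≤ c • Y - Y := sub_le_sub_right hXY Y
      _ = (c - 1) • Y := by module
      _ ≤ (c - 1) • r • 1 := smul_le_smul_of_nonneg_left hY hc
      _ = ((c - 1) * r) • 1 := smul_smul _ _ _
  refine SymOp.norm_le_of_mem_Icc (by positivity) ⟨?_, hbound P Q hPQ hQ⟩
  rw [neg_smul, neg_le, neg_sub]
  exact hbound Q P hQP hP

theorem eventually_riccatiField_smul_one_nonneg (A : E →L[𝕜] E) (S : SymOp 𝕜 E) (hm : 0 < m)
    (hD : m • (1 : SymOp 𝕜 E) ≤ D) :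
    ∀ᶠ ε in 𝓝[>] (0 : ℝ), 0 ≤ riccatiField A D S (ε • (1 : SymOp 𝕜 E)) := by
  have hcont : Continuous fun ε : ℝ => riccatiField A D S (ε • (1 : SymOp 𝕜 E)) :=
    (lipschitzOnBounded_riccatiField A D S).continuous.comp (by fun_prop)
  have hlim := (hcont.tendsto 0).mono_left (nhdsWithin_le_nhds (s := Ioi 0))
  rw [zero_smul, riccatiField_zero] at hlim
  filter_upwards [Metric.tendsto_nhds.mp hlim m hm] with ε hε
  rw [dist_comm, dist_eq_norm] at hε
  have hsub : D - riccatiField A D S (ε • 1) ≤ m • (1 : SymOp 𝕜 E) :=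
    (SymOp.le_norm_smul_one _).trans (smul_le_smul_of_nonneg_right hε.le SymOp.one_nonneg)
  exact (sub_le_self_iff D).mp (hsub.trans hD)

theorem flow_mem_Icc {U V : SymOp 𝕜 E} (hU : 0 ≤ riccatiField A D S U)
    (hV : riccatiField A D S V ≤ 0) (hP : P ∈ Icc U V)
    (hsol : ∀ a, IsSolution (riccatiField A D S) P a fun t => flow (riccatiField A D S) t P)
    (ht : 0 ≤ t) : flow (riccatiField A D S) t P ∈ Icc U V :=
  (hsol (t + 1)).mem_Icc hU hV hP ⟨ht, lt_add_one t⟩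

theorem flow_mem_posUpTo (hm : 0 < m) (hD : m • (1 : SymOp 𝕜 E) ≤ D) (hr : 0 ≤ r)
    (hV : riccatiField A D S (r • (1 : SymOp 𝕜 E)) ≤ 0) (hP : P ∈ posUpTo 𝕜 E r)
    (ht : 0 ≤ t) : flow (riccatiField A D S) t P ∈ posUpTo 𝕜 E r := by
  obtain ⟨⟨δ, hδ, hδP⟩, hPr⟩ := mem_posUpTo_iff.mp hP
  obtain ⟨ε, hU, hε, hεδ⟩ := ((eventually_riccatiField_smul_one_nonneg A S hm hD).and
    (Ioc_mem_nhdsGT hδ)).exists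
  have hεP := (smul_le_smul_of_nonneg_right hεδ SymOp.one_nonneg).trans hδP
  have hsol := isSolution_flow_riccatiField ((smul_nonneg hm.le SymOp.one_nonneg).trans hD) hr hV
    (mem_Icc_of_mem_posUpTo hP)
  exact mem_posUpTo_of_mem_Icc hε (flow_mem_Icc hU hV ⟨hεP, hPr⟩ hsol ht)

theorem thompsonDist_flow_le (hD : m • (1 : SymOp 𝕜 E) ≤ D) (hk : 0 ≤ k)
    (hS : (-k) • (1 : SymOp 𝕜 E) ≤ S) (hr : 0 ≤ r)
    (hV : riccatiField A D S (r • (1 : SymOp 𝕜 E)) ≤ 0) (hα : 0 ≤ α)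
    (hαr : α * r ≤ m - k * r ^ 2) (hP : P ∈ Icc 0 (r • (1 : SymOp 𝕜 E)))
    (hQ : Q ∈ Icc 0 (r • (1 : SymOp 𝕜 E))) (hPQ : SamePart P Q) (ht : 0 ≤ t) :
    thompsonDist (flow (riccatiField A D S) t P) (flow (riccatiField A D S) t Q) ≤
      Real.exp (-α * t) * thompsonDist P Q := by
  have hm : 0 ≤ m := by linarith [mul_nonneg hα hr, mul_nonneg hk (sq_nonneg r)]
  have hD₀ : 0 ≤ D := (smul_nonneg hm SymOp.one_nonneg).trans hD
  have hU : 0 ≤ riccatiField A D S 0 := (riccatiField_zero A D S).symm ▸ hD₀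
  have hsolP := isSolution_flow_riccatiField hD₀ hr hV hP
  have hsolQ := isSolution_flow_riccatiField hD₀ hr hV hQ
  have hPr := fun u hu => flow_mem_Icc (t := u) hU hV hP hsolP hu
  have hQr := fun u hu => flow_mem_Icc (t := u) hU hV hQ hsolQ hu
  have hs := hPQ.thompsonDist_nonneg
  obtain ⟨hPQ_le, hQP_le⟩ := (hPQ.thompsonDist_le_iff hs).mp le_rfl
  have hle := (hsolP (t + 1)).le_exp_smul (hsolQ (t + 1)) hD hk hS hr hα hαr
    (fun u hu => hPr u hu.1) hs hPQ_le ⟨ht, lt_add_one t⟩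
  have hge := (hsolQ (t + 1)).le_exp_smul (hsolP (t + 1)) hD hk hS hr hα hαr
    (fun u hu => hQr u hu.1) hs hQP_le ⟨ht, lt_add_one t⟩
  have hpart : SamePart (flow (riccatiField A D S) t P) (flow (riccatiField A D S) t Q) :=
    ⟨(hPr t ht).1, (hQr t ht).1, ⟨_, hle⟩, _, hge⟩
  exact (hpart.thompsonDist_le_iff (by positivity)).mpr ⟨hle, hge⟩

theorem eq_of_riccatiField_eq_zero (hD : m • (1 : SymOp 𝕜 E) ≤ D) (hk : 0 ≤ k)
    (hS : (-k) • (1 : SymOp 𝕜 E) ≤ S) (hr : 0 < r)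
    (hV : riccatiField A D S (r • (1 : SymOp 𝕜 E)) ≤ 0) (hkr : k * r ^ 2 < m)
    (hP : P ∈ Icc 0 (r • (1 : SymOp 𝕜 E))) (hQ : Q ∈ Icc 0 (r • (1 : SymOp 𝕜 E)))
    (hPQ : SamePart P Q) (hP₀ : riccatiField A D S P = 0) (hQ₀ : riccatiField A D S Q = 0) :
    P = Q := by
  have hφ := lipschitzOnBounded_riccatiField A D S
  have hα : 0 < (m - k * r ^ 2) / r := div_pos (sub_pos.mpr hkr) hr
  have hcontr := thompsonDist_flow_le hD hk hS hr.le hV hα.le (div_mul_cancel₀ _ hr.ne').le hP hQ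
    hPQ zero_le_one
  rw [flow_eq_self hφ hP₀ zero_le_one, flow_eq_self hφ hQ₀ zero_le_one] at hcontr
  refine hPQ.eq_of_thompsonDist_le_zero ?_
  by_contra! hpos
  refine (mul_lt_of_lt_one_left hpos (Real.exp_lt_one_iff.mpr ?_)).not_ge hcontr
  linarith

theorem cauchySeq_of_dist_add_le {X : Type*} [PseudoMetricSpace X] {f : ℝ → X} {b : ℝ → ℝ}
    (hb : Tendsto b atTop (𝓝 0))
    (hf : ∀ t ≥ 0, ∀ h ≥ 0, dist (f (t + h)) (f t) ≤ b t) : CauchySeq f := by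
  refine Metric.cauchySeq_iff'.mpr fun δ hδ => ?_
  obtain ⟨T, hT, hT0⟩ := ((hb.eventually_lt_const hδ).and (eventually_ge_atTop 0)).exists
  refine ⟨T, fun t ht => lt_of_le_of_lt ?_ hT⟩
  simpa only [add_sub_cancel] using hf T hT0 (t - T) (sub_nonneg.mpr ht)

theorem tendsto_exp_exp_neg_mul_sub_one (hα : 0 < α) (s : ℝ) :
    Tendsto (fun t => Real.exp (Real.exp (-α * t) * s) - 1) atTop (𝓝 0) := by
  have hexp : Tendsto (fun t => Real.exp (-α * t)) atTop (𝓝 0) :=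
    Real.tendsto_exp_atBot.comp (tendsto_id.const_mul_atTop_of_neg (neg_lt_zero.mpr hα))
  have h := ((Real.continuous_exp.tendsto _).comp (hexp.mul_const s)).sub_const 1
  rwa [zero_mul, Real.exp_zero, sub_self] at h

theorem cauchySeq_flow (hD : m • (1 : SymOp 𝕜 E) ≤ D) (hk : 0 ≤ k)
    (hS : (-k) • (1 : SymOp 𝕜 E) ≤ S) (hε : 0 < ε) (hεr : ε ≤ r)
    (hU : 0 ≤ riccatiField A D S (ε • (1 : SymOp 𝕜 E)))
    (hV : riccatiField A D S (r • (1 : SymOp 𝕜 E)) ≤ 0) (hkr : k * r ^ 2 < m)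
    (hP : P ∈ Icc (ε • (1 : SymOp 𝕜 E)) (r • (1 : SymOp 𝕜 E)))
    (hsol : ∀ a, IsSolution (riccatiField A D S) P a fun t => flow (riccatiField A D S) t P) :
    CauchySeq fun t => flow (riccatiField A D S) t P := by
  have hr : 0 < r := hε.trans_le hεr
  have hα : 0 < (m - k * r ^ 2) / r := div_pos (sub_pos.mpr hkr) hr
  have hmem := fun u hu => flow_mem_Icc (t := u) hU hV hP hsol hu
  have hpos := fun u hu => mem_posUpTo_of_mem_Icc hε (hmem u hu)
  refine cauchySeq_of_dist_add_le
    (b := fun t => (Real.exp (Real.exp (-((m - k * r ^ 2) / r) * t) * Real.log (r / ε)) - 1) * r)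
    ?_ fun t ht h hh => ?_
  · simpa only [zero_mul] using
      (tendsto_exp_exp_neg_mul_sub_one hα (Real.log (r / ε))).mul_const r
  have hP' := mem_posUpTo_of_mem_Icc hε hP
  have hcontr := thompsonDist_flow_le hD hk hS hr.le hV hα.le (div_mul_cancel₀ _ hr.ne').le
    (mem_Icc_of_mem_posUpTo (hpos h hh)) (mem_Icc_of_mem_posUpTo hP')
    (samePart_of_mem_posUpTo hr.le (hpos h hh) hP') ht
  rw [← flow_add (lipschitzOnBounded_riccatiField A D S) (fun a => ⟨_, hsol a⟩) ht hh] at hcontr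
  rw [dist_eq_norm]
  refine ((samePart_of_mem_posUpTo hr.le (hpos _ (add_nonneg ht hh)) (hpos t ht)).norm_sub_le hr.le
    (hmem _ (add_nonneg ht hh)).2 (hmem t ht).2).trans ?_
  gcongr
  refine hcontr.trans ?_
  gcongr
  exact thompsonDist_le_log_div hε hεr (hmem h hh) hP

theorem exists_riccatiField_eq_zero (hD : m • (1 : SymOp 𝕜 E) ≤ D) (hk : 0 ≤ k)
    (hS : (-k) • (1 : SymOp 𝕜 E) ≤ S) (hr : 0 < r)
    (hV : riccatiField A D S (r • (1 : SymOp 𝕜 E)) ≤ 0) (hkr : k * r ^ 2 < m) :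
    ∃ P ∈ posUpTo 𝕜 E r, riccatiField A D S P = 0 := by
  have hm : 0 < m := (by positivity : 0 ≤ k * r ^ 2).trans_lt hkr
  obtain ⟨ε, hU, hε, hεr⟩ := ((eventually_riccatiField_smul_one_nonneg A S hm hD).and
    (Ioc_mem_nhdsGT hr)).exists
  have hP : r • (1 : SymOp 𝕜 E) ∈ Icc (ε • (1 : SymOp 𝕜 E)) (r • 1) :=
    ⟨smul_le_smul_of_nonneg_right hεr SymOp.one_nonneg, le_rfl⟩
  have hsol := isSolution_flow_riccatiField ((smul_nonneg hm.le SymOp.one_nonneg).trans hD) hr.le hV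
    ⟨smul_nonneg hr.le SymOp.one_nonneg, le_rfl⟩
  obtain ⟨Y, hY⟩ := cauchySeq_tendsto_of_complete
    (cauchySeq_flow hD hk hS hε hεr hU hV hkr hP hsol)
  have hYmem := isClosed_Icc.mem_of_tendsto hY <|
    (eventually_ge_atTop 0).mono fun t ht => flow_mem_Icc hU hV hP hsol ht
  exact ⟨Y, mem_posUpTo_of_mem_Icc hε hYmem,
    eq_zero_of_tendsto (lipschitzOnBounded_riccatiField A D S).continuous hsol hY⟩

end Equilibrium

section Supersolution

variable {𝕜 E : Type*} [RCLike 𝕜] [NormedAddCommGroup E] [InnerProductSpace 𝕜 E]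
  [CompleteSpace E] {A : E →L[𝕜] E} {D S : SymOp 𝕜 E}

theorem SymOp.smul_one_le_smul_one_iff [Nontrivial E] {a b : ℝ} :
    a • (1 : SymOp 𝕜 E) ≤ b • (1 : SymOp 𝕜 E) ↔ a ≤ b := by
  refine ⟨fun h => ?_, fun h => smul_le_smul_of_nonneg_right h one_nonneg⟩
  obtain ⟨x, hx⟩ := exists_ne (0 : E)
  have hle := le_iff_reApplyInnerSelf.mp h x
  rw [reApplyInnerSelf_smul_one, reApplyInnerSelf_smul_one] at hle
  exact le_of_mul_le_mul_right hle (by positivity)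

instance SymOp.instSubsingleton [Subsingleton E] : Subsingleton (SymOp 𝕜 E) :=
  inferInstanceAs (Subsingleton {T : E →L[𝕜] E // T ∈ selfAdjoint (E →L[𝕜] E)})

theorem riccatiField_smul_one_nonpos {a d k r : ℝ}
    (hA : A + star A ≤ (((-(2 * a)) • (1 : SymOp 𝕜 E) : SymOp 𝕜 E) : E →L[𝕜] E))
    (hD : D ≤ d • (1 : SymOp 𝕜 E)) (hS : (-k) • (1 : SymOp 𝕜 E) ≤ S) (hr : 0 ≤ r)
    (hquad : k * r ^ 2 - 2 * a * r + d ≤ 0) :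
    riccatiField A D S (r • (1 : SymOp 𝕜 E)) ≤ 0 := by
  have hlyap : lyapunov A (1 : SymOp 𝕜 E) ≤ (-(2 * a)) • (1 : SymOp 𝕜 E) := by
    rwa [SymOp.le_iff, coe_lyapunov, SymOp.coe_one, mul_one, one_mul, add_comm]
  have hcongr : congruence ((r • 1 : SymOp 𝕜 E) : E →L[𝕜] E) S = r ^ 2 • S := Subtype.ext <| by
    simp [coe_congruence, SymOp.coe_smul, SymOp.coe_one, smul_smul, pow_two]
  rw [riccatiField_eq, map_smul, hcongr]
  calc r • lyapunov A 1 + D - r ^ 2 • S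
    _ ≤ r • (-(2 * a)) • (1 : SymOp 𝕜 E) + d • 1 - r ^ 2 • (-k) • 1 := by gcongr
    _ = (k * r ^ 2 - 2 * a * r + d) • 1 := by module
    _ ≤ 0 := smul_nonpos_of_nonpos_of_nonneg hquad SymOp.one_nonneg

theorem quadratic_nonpos_of_root_le {a d k r : ℝ} (ha : 0 ≤ a) (hk : 0 < k) (hdisc : d * k ≤ a ^ 2)
    (hroot : (a - √(a ^ 2 - d * k)) / k ≤ r) (hkr : k * r ^ 2 ≤ d) :
    k * r ^ 2 - 2 * a * r + d ≤ 0 := by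
  have hlower : a - k * r ≤ √(a ^ 2 - d * k) := by
    rw [div_le_iff₀ hk] at hroot
    linarith
  have hupper : k * r ≤ a := by
    refine le_of_sq_le_sq ?_ ha
    calc (k * r) ^ 2 = k * (k * r ^ 2) := by ring
      _ ≤ k * d := by gcongr
      _ ≤ a ^ 2 := by linarith
  have hsq : (a - k * r) ^ 2 ≤ a ^ 2 - d * k := by
    rw [← Real.sq_sqrt (sub_nonneg.mpr hdisc)]
    exact pow_le_pow_left₀ (sub_nonneg.mpr hupper) hlower 2
  refine nonpos_of_mul_nonpos_right (a := k) ?_ hk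
  linarith

theorem riccatiField_smul_one_nonpos_of_root_le {a d k m r : ℝ} (ha : 0 ≤ a) (hk : 0 < k)
    (hA : A + star A ≤ (((-(2 * a)) • (1 : SymOp 𝕜 E) : SymOp 𝕜 E) : E →L[𝕜] E))
    (hDm : m • (1 : SymOp 𝕜 E) ≤ D) (hDd : D ≤ d • (1 : SymOp 𝕜 E))
    (hS : (-k) • (1 : SymOp 𝕜 E) ≤ S) (hdisc : d * k ≤ a ^ 2) (hr : 0 ≤ r)
    (hroot : (a - √(a ^ 2 - d * k)) / k ≤ r) (hkr : k * r ^ 2 ≤ m) :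
    riccatiField A D S (r • (1 : SymOp 𝕜 E)) ≤ 0 := by
  rcases subsingleton_or_nontrivial E with _ | _
  · exact (Subsingleton.elim _ _).le
  · have hmd : m ≤ d := SymOp.smul_one_le_smul_one_iff.mp (hDm.trans hDd)
    exact riccatiField_smul_one_nonpos hA hDd hS hr
      (quadratic_nonpos_of_root_le ha hk hdisc hroot (hkr.trans hmd))

theorem sub_sqrt_sq_sub_pos {a b : ℝ} (ha : 0 < a) (hb : 0 < b) : 0 < a - √(a ^ 2 - b) :=
  sub_pos.mpr ((Real.sqrt_lt' ha).mpr (by linarith))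

end Supersolution

end Riccati

end

open Riccati Set in
theorem mainTheorem11_general {𝕜 E : Type*} [RCLike 𝕜] [NormedAddCommGroup E]
    [InnerProductSpace 𝕜 E] [CompleteSpace E] (A : E →L[𝕜] E) (D S : SymOp 𝕜 E) (mD cS r : ℝ)
    (hcS : 0 ≤ cS) (hD : mD • (1 : SymOp 𝕜 E) ≤ D) (hS : (-cS) • (1 : SymOp 𝕜 E) ≤ S)
    (hr : 0 < r) (hsuper : riccatiField A D S (r • (1 : SymOp 𝕜 E)) ≤ 0)
    (hgap : cS * r ^ 2 < mD) :
    (∀ P ∈ posUpTo 𝕜 E r,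
      (∀ a : ℝ, IsSolution (riccatiField A D S) P a
        (fun t => flow (riccatiField A D S) t P)) ∧
      (∀ (a : ℝ) (x : ℝ → SymOp 𝕜 E),
        IsSolution (riccatiField A D S) P a x →
        ∀ t ∈ Ico 0 a, x t = flow (riccatiField A D S) t P) ∧
      ∀ t : ℝ, 0 ≤ t →
        flow (riccatiField A D S) t P ∈ posUpTo 𝕜 E r) ∧
    ∃ α : ℝ, 0 < α ∧ (mD - cS * r ^ 2) / r ≤ α ∧
      (∀ P₁ ∈ posUpTo 𝕜 E r, ∀ P₂ ∈ posUpTo 𝕜 E r, ∀ t : ℝ, 0 ≤ t →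
        thompsonDist (flow (riccatiField A D S) t P₁)
            (flow (riccatiField A D S) t P₂)
          ≤ Real.exp (-α * t) * thompsonDist P₁ P₂) ∧
      ∃ Pbar ∈ posUpTo 𝕜 E r,
        SolvesARE A D S Pbar ∧
        (∀ Q ∈ posUpTo 𝕜 E r, SolvesARE A D S Q → Q = Pbar) ∧
        ∀ P ∈ posUpTo 𝕜 E r, ∀ t : ℝ, 0 ≤ t →
          thompsonDist (flow (riccatiField A D S) t P) Pbar
            ≤ Real.exp (-α * t) * thompsonDist P Pbar := by
  have hmD : 0 < mD := (mul_nonneg hcS (sq_nonneg r)).trans_lt hgap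
  have hD₀ : 0 ≤ D := (smul_nonneg hmD.le SymOp.one_nonneg).trans hD
  have hα : 0 < (mD - cS * r ^ 2) / r := div_pos (sub_pos.mpr hgap) hr
  have hcontr : ∀ P₁ ∈ posUpTo 𝕜 E r, ∀ P₂ ∈ posUpTo 𝕜 E r, ∀ t : ℝ, 0 ≤ t →
      thompsonDist (flow (riccatiField A D S) t P₁) (flow (riccatiField A D S) t P₂) ≤
        Real.exp (-((mD - cS * r ^ 2) / r) * t) * thompsonDist P₁ P₂ := fun P₁ h₁ P₂ h₂ _ ht =>
    thompsonDist_flow_le hD hcS hS hr.le hsuper hα.le (div_mul_cancel₀ _ hr.ne').le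
      (mem_Icc_of_mem_posUpTo h₁) (mem_Icc_of_mem_posUpTo h₂)
      (samePart_of_mem_posUpTo hr.le h₁ h₂) ht
  have hφ := lipschitzOnBounded_riccatiField A D S
  obtain ⟨Pbar, hPbar, hzero⟩ := exists_riccatiField_eq_zero hD hcS hS hr hsuper hgap
  refine ⟨fun P hP => ⟨isSolution_flow_riccatiField hD₀ hr.le hsuper (mem_Icc_of_mem_posUpTo hP),
    fun a x hx t ht => hx.eq_flow hφ ht, fun t ht => flow_mem_posUpTo hmD hD hr.le hsuper hP ht⟩,
    _, hα, le_rfl, hcontr, Pbar, hPbar, (riccatiField_eq_zero_iff A D S Pbar).mp hzero,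
    fun Q hQ hQ₀ => ?_, fun P hP t ht => ?_⟩
  · exact eq_of_riccatiField_eq_zero hD hcS hS hr hsuper hgap (mem_Icc_of_mem_posUpTo hQ)
      (mem_Icc_of_mem_posUpTo hPbar) (samePart_of_mem_posUpTo hr.le hQ hPbar)
      ((riccatiField_eq_zero_iff A D S Q).mpr hQ₀) hzero
  · simpa only [flow_eq_self hφ hzero ht] using hcontr P hP Pbar hPbar t ht

theorem mainTheorem11 {𝕜 E : Type*} [RCLike 𝕜] [NormedAddCommGroup E] [InnerProductSpace 𝕜 E]
    [CompleteSpace E]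
    (A : E →L[𝕜] E) (D S : Riccati.SymOp 𝕜 E) (cA cD mD cS : ℝ)
    (hcA : 0 < cA) (hcD : 0 < cD) (hmD : 0 < mD) (hcS : 0 < cS)
    (hA : A + star A ≤ (((-(2 * cA)) • (1 : Riccati.SymOp 𝕜 E) : Riccati.SymOp 𝕜 E) : E →L[𝕜] E))
    (hD_lower : mD • (1 : Riccati.SymOp 𝕜 E) ≤ D)
    (hD_upper : D ≤ cD • (1 : Riccati.SymOp 𝕜 E))
    (hS : (-cS) • (1 : Riccati.SymOp 𝕜 E) ≤ S)
    (h1 : cD * cS ≤ cA ^ 2)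
    (h2 : (cA - Real.sqrt (cA ^ 2 - cD * cS)) ^ 2 < cS * mD)
    (r : ℝ)
    (hr : r ∈ Set.Ico ((cA - Real.sqrt (cA ^ 2 - cD * cS)) / cS) (Real.sqrt (mD / cS))) :
    -- the maximal solution from each point of `(0, r I]` is unique, global, and stays there
    (∀ P ∈ Riccati.posUpTo 𝕜 E r,
      (∀ a : ℝ, Riccati.IsSolution (Riccati.riccatiField A D S) P a
        (fun t => Riccati.flow (Riccati.riccatiField A D S) t P)) ∧
      (∀ (a : ℝ) (x : ℝ → Riccati.SymOp 𝕜 E),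
        Riccati.IsSolution (Riccati.riccatiField A D S) P a x →
        ∀ t ∈ Set.Ico 0 a, x t = Riccati.flow (Riccati.riccatiField A D S) t P) ∧
      ∀ t : ℝ, 0 ≤ t →
        Riccati.flow (Riccati.riccatiField A D S) t P ∈ Riccati.posUpTo 𝕜 E r) ∧
    ∃ α : ℝ, 0 < α ∧ (mD - cS * r ^ 2) / r ≤ α ∧
      (∀ P₁ ∈ Riccati.posUpTo 𝕜 E r, ∀ P₂ ∈ Riccati.posUpTo 𝕜 E r, ∀ t : ℝ, 0 ≤ t →
        Riccati.thompsonDist (Riccati.flow (Riccati.riccatiField A D S) t P₁)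
            (Riccati.flow (Riccati.riccatiField A D S) t P₂)
          ≤ Real.exp (-α * t) * Riccati.thompsonDist P₁ P₂) ∧
      ∃ Pbar ∈ Riccati.posUpTo 𝕜 E r,
        Riccati.SolvesARE A D S Pbar ∧
        (∀ Q ∈ Riccati.posUpTo 𝕜 E r, Riccati.SolvesARE A D S Q → Q = Pbar) ∧
        ∀ P ∈ Riccati.posUpTo 𝕜 E r, ∀ t : ℝ, 0 ≤ t →
          Riccati.thompsonDist (Riccati.flow (Riccati.riccatiField A D S) t P) Pbar
            ≤ Real.exp (-α * t) * Riccati.thompsonDist P Pbar := by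
  have hr₀ : 0 < r :=
    (div_pos (Riccati.sub_sqrt_sq_sub_pos hcA (mul_pos hcD hcS)) hcS).trans_le hr.1
  have hgap : cS * r ^ 2 < mD := (lt_div_iff₀' hcS).mp ((Real.lt_sqrt hr₀.le).mp hr.2)
  exact mainTheorem11_general A D S mD cS r hcS.le hD_lower hS hr₀
    (Riccati.riccatiField_smul_one_nonpos_of_root_le hcA.le hcS hA hD_lower hD_upper hS h1 hr₀.le
      hr.1 hgap.le) hgap
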